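/- For $1\le t\le\infty$ let $\|A\|_t=(\operatorname{Tr}|A|^t)^{1/t}$ denote the Schatten norm of a complex square matrix ($\|A\|_\infty$ is the operator norm). For $Y\in M_d\otimes M_n$ and $1\le t,p\le\infty$ put $$\|Y\|_{(\infty,p)}=\sup_{0\ne A,B\in M_d}\frac{\|(A\otimes I_n)Y(B\otimes I_n)\|_p}{\|A\|_{2p}\,\|B\|_{2p}},\qquad \|Y\|_{(t,p)}=\inf_{\substack{Y=(A\otimes I_n)Z(B\otimes I_n)\\ A,B\in M_d,\ Z\in M_d\otimes M_n}}\|A\|_{2t}\,\|B\|_{2t}\,\|Z\|_{(\infty,p)},$$ and let $L_t(M_d;L_p(M_n))$ be $M_d\otimes M_n$ with the norm $\|\cdot\|_{(t,p)}$. **Theorem.** Let $d,m\ge 1$, $1\le q\le p\le\infty$, and let $\Phi:M_m\to M_n$ be linear and completely positive, i.e. $\mathcal I_k\otimes\Phi$ maps positive semidefinite matrices to positive semidefinite matrices for every $k$. Then the norm of $\mathcal I_d\otimes\Phi:L_q(M_d;L_q(M_m))\to L_q(M_d;L_p(M_n))$ is achieved with a positive semidefinite matrix: $$\|\mathcal I_d\otimes\Phi\|_{(q,q)\to(q,p)}:=\sup_{0\ne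 Q\in M_d\otimes M_m}\frac{\|(\mathcal I_d\otimes\Phi)(Q)\|_{(q,p)}}{\|Q\|_{(q,q)}} =\sup_{\substack{0\ne Q\in M_d\otimes M_m\\ Q\ge 0}}\frac{\|(\mathcal I_d\otimes\Phi)(Q)\|_{(q,p)}}{\|Q\|_{(q,q)}},$$ and there is a nonzero positive semidefinite $Q\in M_d\otimes M_m$ at which the ratio equals this common value. -/

import Mathlib

open scoped ENNReal Kronecker ComplexOrder

noncomputable section

namespace CBNorm

/-- The singular values of a square complex matrix `A`: the square roots of the eigenvalues of
`Aᴴ * A`, with multiplicity, i.e. the eigenvalues of `|A|`. -/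
def singularValue {ι : Type*} [Fintype ι] [DecidableEq ι] (A : Matrix ι ι ℂ) (i : ι) : ℝ :=
  Real.sqrt ((Matrix.isHermitian_conjTranspose_mul_self A).eigenvalues i)

/-- The Schatten norm `‖A‖_p = (Tr |A|^p)^{1/p}`, the operator norm when `p = ∞`. -/
def schattenNorm {ι : Type*} [Fintype ι] [DecidableEq ι] (p : ℝ≥0∞) (A : Matrix ι ι ℂ) : ℝ≥0∞ :=
  if p = ∞ then ⨆ i, ENNReal.ofReal (singularValue A i)
  else (∑ i, ENNReal.ofReal (singularValue A i) ^ p.toReal) ^ (1 / p.toReal)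

/-- `A ⊗ I_n`. -/
def ampl {d : ℕ} (n : ℕ) (A : Matrix (Fin d) (Fin d) ℂ) :
    Matrix (Fin d × Fin n) (Fin d × Fin n) ℂ :=
  A ⊗ₖ (1 : Matrix (Fin n) (Fin n) ℂ)

/-- The norm of `L_∞(M_d; L_p(M_n))`:
`sup_{A,B} ‖(A ⊗ I) Y (B ⊗ I)‖_p / (‖A‖_{2p} ‖B‖_{2p})`, over nonzero `A`, `B`. -/
def normInf {d n : ℕ} (p : ℝ≥0∞) (Y : Matrix (Fin d × Fin n) (Fin d × Fin n) ℂ) : ℝ≥0∞ :=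
  ⨆ (A : Matrix (Fin d) (Fin d) ℂ) (B : Matrix (Fin d) (Fin d) ℂ) (_ : A ≠ 0) (_ : B ≠ 0),
    schattenNorm p (ampl n A * Y * ampl n B) / (schattenNorm (2 * p) A * schattenNorm (2 * p) B)

/-- The norm of `L_t(M_d; L_p(M_n))`:
`inf ‖A‖_{2t} ‖B‖_{2t} ‖Z‖_{(∞,p)}` over all factorizations `Y = (A ⊗ I) Z (B ⊗ I)`. -/
def mixedNorm {d n : ℕ} (t p : ℝ≥0∞) (Y : Matrix (Fin d × Fin n) (Fin d × Fin n) ℂ) : ℝ≥0∞ :=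
  ⨅ (A : Matrix (Fin d) (Fin d) ℂ) (B : Matrix (Fin d) (Fin d) ℂ)
    (Z : Matrix (Fin d × Fin n) (Fin d × Fin n) ℂ) (_ : Y = ampl n A * Z * ampl n B),
    schattenNorm (2 * t) A * schattenNorm (2 * t) B * normInf p Z

/-- The map `I_d ⊗ Φ` on `M_d ⊗ M_m`: `Φ` is applied to each `m × m` block. -/
def idTensor {m n : ℕ} (d : ℕ) (Φ : Matrix (Fin m) (Fin m) ℂ →ₗ[ℂ] Matrix (Fin n) (Fin n) ℂ)
    (Y : Matrix (Fin d × Fin m) (Fin d × Fin m) ℂ) :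
    Matrix (Fin d × Fin n) (Fin d × Fin n) ℂ :=
  Matrix.of fun x y => Φ (Matrix.of fun k l => Y (x.1, k) (y.1, l)) x.2 y.2

/-- Complete positivity: every `I_k ⊗ Φ` maps positive semidefinite matrices to positive
semidefinite matrices. -/
def IsCompletelyPositive {m n : ℕ}
    (Φ : Matrix (Fin m) (Fin m) ℂ →ₗ[ℂ] Matrix (Fin n) (Fin n) ℂ) : Prop :=
  ∀ (k : ℕ) (Y : Matrix (Fin k × Fin m) (Fin k × Fin m) ℂ),
    Y.PosSemidef → (idTensor k Φ Y).PosSemidef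

/-- The norm `‖Ω‖_{(t,q) → (s,p)}` of a map
`Ω : L_t(M_d; L_q(M_m)) → L_s(M_{d'}; L_p(M_n))`. -/
def opNorm {d m d' n : ℕ} (t q s p : ℝ≥0∞)
    (Ω : Matrix (Fin d × Fin m) (Fin d × Fin m) ℂ →
      Matrix (Fin d' × Fin n) (Fin d' × Fin n) ℂ) : ℝ≥0∞ :=
  ⨆ (Q : Matrix (Fin d × Fin m) (Fin d × Fin m) ℂ) (_ : Q ≠ 0),
    mixedNorm s p (Ω Q) / mixedNorm t q Q

/-- The quantity `‖Ω‖⁺_{(t,q) → (s,p)}`: the same supremum, over nonzero positive semidefinite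
matrices only. -/
def opNormPos {d m d' n : ℕ} (t q s p : ℝ≥0∞)
    (Ω : Matrix (Fin d × Fin m) (Fin d × Fin m) ℂ →
      Matrix (Fin d' × Fin n) (Fin d' × Fin n) ℂ) : ℝ≥0∞ :=
  ⨆ (Q : Matrix (Fin d × Fin m) (Fin d × Fin m) ℂ) (_ : Q ≠ 0) (_ : Q.PosSemidef),
    mixedNorm s p (Ω Q) / mixedNorm t q Q

end CBNorm

end

/-! Write `‖Q‖_q` for the Schatten norm. Everything rests on a Cauchy-Schwarz inequality for mixed
norms: if the block matrix `[X, Y; Yᴴ, W]` is positive semidefinite, then `‖Y‖² ≤ ‖X‖ ‖W‖` in the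
`(t,p)` norm (`mixedNorm_sq_le_of_posSemidef`).

Given this, let `Q = U D V` be a singular value decomposition. The matrices `X = U D Uᴴ` and `W = Vᴴ
D V` are positive, have the same Schatten norms as `Q`, and bound `Q` in a positive block matrix.
Complete positivity carries this block matrix to one with entries the images of `X`, `Q`, `W`, so
the image of `Q` is controlled by the images of two positive matrices of the same Schatten norm. The
denominators agree with Schatten norms as far as needed: `‖Q‖_q ≤ ‖Q‖_{(q,q)}` for every `Q`, with
equality for positive `Q` (`mixedNorm_eq_schattenNorm_of_posSemidef`). The supremum over positive
matrices is attained because the set of those with `‖Q‖_q = 1` is compact and the numerator is upper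
semicontinuous there (`upperSemicontinuousAt_mixedNorm`).

For Schatten norms the Cauchy-Schwarz inequality comes from duality and a discriminant; it passes to
`(∞,p)` by conjugating the blocks with `C ⊗ I` and `D ⊗ I`. To reach `(t,p)`, the Hermitian corners
need near-optimal symmetric factorizations `X = (a ⊗ I) H (a ⊗ I)ᴴ`. From `X = A Z B` with `B = V P²
Aᴴ` (polar decomposition), take `a = A P`. Then `H` is Hermitian and similar to `Z V` through `P`,
and the three lines theorem shows that this similarity does not make `H` larger
(`normInf_le_of_hermitian_conj`).

Equality of the two `q`-norms on positive definite `Q` uses `σ = Tr₂ Q^q` and the factorization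
through `σ^{1/(2q)}`; a second three lines argument (`schattenNorm_ampl_mul_le_one`) bounds the
middle factor by `1`. -/

namespace CBNorm
open Matrix

/-! ### Singular value decomposition; Schatten norms as `ℓ^p` norms. -/

section
open scoped Matrix.Norms.L2Operator

variable {ι : Type*} [Fintype ι] [DecidableEq ι]

theorem singularValue_nonneg (A : Matrix ι ι ℂ) (i : ι) : 0 ≤ singularValue A i :=
  Real.sqrt_nonneg _

theorem sq_singularValue (A : Matrix ι ι ℂ) (i : ι) :
    singularValue A i ^ 2 = (isHermitian_conjTranspose_mul_self A).eigenvalues i :=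
  Real.sq_sqrt ((posSemidef_conjTranspose_mul_self A).eigenvalues_nonneg i)

/-- Singular value decomposition of a square matrix. -/
theorem exists_svd (A : Matrix ι ι ℂ) :
    ∃ U ∈ unitaryGroup ι ℂ, ∃ V ∈ unitaryGroup ι ℂ,
      A = U * diagonal (fun i => (singularValue A i : ℂ)) * V := by
  set hA := isHermitian_conjTranspose_mul_self A
  set W : Matrix ι ι ℂ := (hA.eigenvectorUnitary : Matrix ι ι ℂ) with hW
  have hW1 : Wᴴ * W = 1 := mem_unitaryGroup_iff'.1 hA.eigenvectorUnitary.2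
  have hW2 : W * Wᴴ = 1 := mem_unitaryGroup_iff.1 hA.eigenvectorUnitary.2
  set M := A * W with hM
  have hMM : Mᴴ * M = diagonal (fun i => ((singularValue A i : ℂ)) ^ 2) := by
    have h := hA.spectral_theorem
    rw [Unitary.conjStarAlgAut_apply] at h
    have : Mᴴ * M = Wᴴ * (Aᴴ * A) * W := by simp [hM, Matrix.mul_assoc]
    rw [this, h]
    change Wᴴ * (W * _ * Wᴴ) * W = _
    rw [show ∀ D : Matrix ι ι ℂ, Wᴴ * (W * D * Wᴴ) * W = (Wᴴ * W) * D * (Wᴴ * W) by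
      intro D; simp only [Matrix.mul_assoc], hW1, Matrix.one_mul, Matrix.mul_one]
    congr 1
    funext i
    simp only [Function.comp, ← sq_singularValue]
    norm_num
  have hent : ∀ i j, ∑ k, star (M k i) * M k j
      = if i = j then ((singularValue A i : ℂ)) ^ 2 else 0 := by
    intro i j
    have := congrFun (congrFun hMM i) j
    simpa [Matrix.mul_apply, diagonal_apply] using this
  let v : ι → EuclideanSpace ℂ ι :=
    fun i => WithLp.toLp 2 (fun k => (singularValue A i : ℂ)⁻¹ * M k i)
  -- The columns of `M = A * W` are orthogonal with lengths the singular values. Those of nonzero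
  -- length, once normalized, extend to an orthonormal basis; the columns of length zero vanish, so
  -- it does not matter which basis vectors are assigned to them.
  have hv : Orthonormal ℂ (({i | singularValue A i ≠ 0} : Set ι).domRestrict v) := by
    rw [orthonormal_iff_ite]
    rintro ⟨i, hi⟩ ⟨j, hj⟩
    have : inner ℂ (v i) (v j) = (singularValue A i : ℂ)⁻¹ * (singularValue A j : ℂ)⁻¹ *
        ∑ k, star (M k i) * M k j := by
      simp only [v, PiLp.inner_apply, RCLike.inner_apply, Finset.mul_sum]
      refine Finset.sum_congr rfl fun k _ => ?_
      simp
      ring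
    change inner ℂ (v i) (v j) = _
    rw [this, hent]
    have hi' : (singularValue A i : ℂ) ≠ 0 := by exact_mod_cast hi
    by_cases hij : i = j
    · subst hij
      simp
      field_simp
    · simp [hij]
  obtain ⟨b, hb⟩ := hv.exists_orthonormalBasis_extension_of_card_eq (by simp)
  set U : Matrix ι ι ℂ := Matrix.of fun k i => b i k with hU
  have hU1 : Uᴴ * U = 1 := by
    ext i j
    have := orthonormal_iff_ite.1 b.orthonormal i j
    simp only [PiLp.inner_apply, RCLike.inner_apply] at this
    simp only [Matrix.mul_apply, conjTranspose_apply, hU, of_apply, Matrix.one_apply, ← this]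
    refine Finset.sum_congr rfl fun k _ => ?_
    rw [mul_comm]; rfl
  have hUM : U * diagonal (fun i => (singularValue A i : ℂ)) = M := by
    ext k i
    rw [mul_diagonal]
    by_cases hi : singularValue A i = 0
    · have := hent i i
      simp only [hi, if_true] at this
      have h0 : ∑ k, Complex.normSq (M k i) = 0 := by
        have h2 : ((∑ k, Complex.normSq (M k i) : ℝ) : ℂ) = 0 := by
          push_cast
          rw [← Complex.ofReal_zero]
          simpa [Complex.normSq_eq_conj_mul_self] using this
        exact_mod_cast h2
      have := (Finset.sum_eq_zero_iff_of_nonneg (fun k _ => Complex.normSq_nonneg _)).1 h0 k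
        (Finset.mem_univ _)
      rw [hi, Complex.normSq_eq_zero.1 this]
      simp
    · have hi' : (singularValue A i : ℂ) ≠ 0 := by exact_mod_cast hi
      simp only [hU, of_apply]
      rw [hb i hi]
      simp only [v]
      field_simp
  refine ⟨U, mem_unitaryGroup_iff'.2 hU1, Wᴴ, mem_unitaryGroup_iff'.2 ?_, ?_⟩
  · simpa [star_eq_conjTranspose] using hW2
  · rw [hUM, hM, Matrix.mul_assoc, hW2, Matrix.mul_one]

/-- The singular values are determined, up to order, by any decomposition `U * diag s * V`. -/
theorem map_singularValue_eq {A U V : Matrix ι ι ℂ} {s : ι → ℝ} (hU : U ∈ unitaryGroup ι ℂ)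
    (hV : V ∈ unitaryGroup ι ℂ) (hs : ∀ i, 0 ≤ s i)
    (h : A = U * diagonal (fun i => (s i : ℂ)) * V) :
    Multiset.map (singularValue A) Finset.univ.val = Multiset.map s Finset.univ.val := by
  have hU1 : Uᴴ * U = 1 := mem_unitaryGroup_iff'.1 hU
  have hV2 : V * Vᴴ = 1 := mem_unitaryGroup_iff.1 hV
  have hAA : Aᴴ * A = Vᴴ * diagonal (fun i => (s i : ℂ) ^ 2) * V := by
    have hd : (diagonal fun i => (s i : ℂ))ᴴ * (diagonal fun i => (s i : ℂ))
        = diagonal fun i => (s i : ℂ) ^ 2 := by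
      rw [diagonal_conjTranspose, diagonal_mul_diagonal]
      congr 1; funext i; simp [sq]
    rw [h, ← hd]
    simp only [conjTranspose_mul, Matrix.mul_assoc]
    rw [← Matrix.mul_assoc Uᴴ U, hU1, Matrix.one_mul]
  -- Eigenvalues are compared as the multiset of roots of a characteristic polynomial, so no
  -- ordering has to be matched.
  have hchar : (Aᴴ * A).charpoly = (diagonal fun i => (s i : ℂ) ^ 2).charpoly := by
    rw [hAA, Matrix.mul_assoc, Matrix.charpoly_mul_comm, Matrix.mul_assoc, hV2, Matrix.mul_one]
  have h1 := (isHermitian_conjTranspose_mul_self A).roots_charpoly_eq_eigenvalues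
  rw [hchar, charpoly_diagonal, Polynomial.roots_prod _ _
    (Finset.prod_ne_zero_iff.2 fun i _ => Polynomial.X_sub_C_ne_zero _)] at h1
  simp only [Polynomial.roots_X_sub_C, Multiset.bind_singleton] at h1
  have := congrArg (Multiset.map fun z : ℂ => Real.sqrt z.re) h1
  simp only [Multiset.map_map] at this
  refine Eq.trans (this.symm : Multiset.map (singularValue A) _ = _) ?_
  refine Multiset.map_congr rfl fun i _ => ?_
  simp only [Function.comp]
  rw [← Complex.ofReal_pow, Complex.ofReal_re, Real.sqrt_sq (hs i)]

/-- The `ℓ^p` norm of a finite family of nonnegative real numbers. -/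
noncomputable def lpSum {κ : Type*} [Fintype κ] (p : ℝ≥0∞) (s : κ → ℝ) : ℝ≥0∞ :=
  if p = ∞ then ⨆ i, ENNReal.ofReal (s i)
  else (∑ i, ENNReal.ofReal (s i) ^ p.toReal) ^ (1 / p.toReal)

/-- Makes the norm computable from any decomposition at hand, free of the enumeration of eigenvalues
in the definition; unitary and adjoint invariance follow at once. -/
theorem schattenNorm_eq_lpSum {A U V : Matrix ι ι ℂ} {s : ι → ℝ} (p : ℝ≥0∞)
    (hU : U ∈ unitaryGroup ι ℂ) (hV : V ∈ unitaryGroup ι ℂ) (hs : ∀ i, 0 ≤ s i)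
    (h : A = U * diagonal (fun i => (s i : ℂ)) * V) : schattenNorm p A = lpSum p s := by
  have hm := map_singularValue_eq hU hV hs h
  unfold schattenNorm lpSum
  split_ifs
  · have hr : Set.range (singularValue A) = Set.range s := by
      ext x
      have := congrArg (x ∈ ·) hm
      simpa using this
    rw [← sSup_range, ← sSup_range, Set.range_comp' ENNReal.ofReal, hr, ← Set.range_comp']
  · congr 1
    have := congrArg (fun m => (m.map fun x => ENNReal.ofReal x ^ p.toReal).sum) hm
    simpa [Multiset.map_map] using this

theorem exists_svd' (A : Matrix ι ι ℂ) :
    ∃ U ∈ unitaryGroup ι ℂ, ∃ V ∈ unitaryGroup ι ℂ, ∃ s : ι → ℝ, (∀ i, 0 ≤ s i) ∧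
      A = U * diagonal (fun i => (s i : ℂ)) * V :=
  let ⟨U, hU, V, hV, h⟩ := exists_svd A
  ⟨U, hU, V, hV, _, singularValue_nonneg A, h⟩

theorem schattenNorm_unitary_mul {U V : Matrix ι ι ℂ} (p : ℝ≥0∞) (hU : U ∈ unitaryGroup ι ℂ)
    (hV : V ∈ unitaryGroup ι ℂ) (A : Matrix ι ι ℂ) :
    schattenNorm p (U * A * V) = schattenNorm p A := by
  obtain ⟨U', hU', V', hV', s, hs, h⟩ := exists_svd' A
  rw [schattenNorm_eq_lpSum p hU' hV' hs h,
    schattenNorm_eq_lpSum p (mul_mem hU hU') (mul_mem hV' hV) hs (by rw [h]; simp only [Matrix.mul_assoc])]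

theorem schattenNorm_conjTranspose (p : ℝ≥0∞) (A : Matrix ι ι ℂ) :
    schattenNorm p Aᴴ = schattenNorm p A := by
  obtain ⟨U, hU, V, hV, s, hs, h⟩ := exists_svd' A
  rw [schattenNorm_eq_lpSum p hU hV hs h,
    schattenNorm_eq_lpSum p (Unitary.star_mem hV) (Unitary.star_mem hU) hs (by
      rw [h]
      simp only [conjTranspose_mul, diagonal_conjTranspose, Matrix.mul_assoc]
      congr 3; funext i; simp)]

theorem lpSum_sq {κ : Type*} [Fintype κ] {p : ℝ≥0∞} (hp : p ≠ 0) {s : κ → ℝ} (hs : ∀ i, 0 ≤ s i) :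
    lpSum p (fun i => s i ^ 2) = lpSum (2 * p) s ^ 2 := by
  unfold lpSum
  by_cases h : p = ∞
  · subst h
    simp only [if_true, ENNReal.mul_top two_ne_zero]
    rw [ENNReal.iSup_pow_of_ne_zero two_ne_zero]
    simp only [ENNReal.ofReal_pow (hs _)]
  · have h2 : 2 * p ≠ ∞ := ENNReal.mul_ne_top ENNReal.ofNat_ne_top h
    rw [if_neg h, if_neg h2]
    have hp' : p.toReal ≠ 0 := (ENNReal.toReal_pos hp h).ne'
    rw [← ENNReal.rpow_natCast, ← ENNReal.rpow_mul, ENNReal.toReal_mul]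
    congr 1
    · refine Finset.sum_congr rfl fun i _ => ?_
      rw [ENNReal.ofReal_pow (hs i), ← ENNReal.rpow_natCast, ← ENNReal.rpow_mul]
      norm_num
    · simp

theorem schattenNorm_mul_conjTranspose_self {p : ℝ≥0∞} (hp : p ≠ 0) (A : Matrix ι ι ℂ) :
    schattenNorm p (A * Aᴴ) = schattenNorm (2 * p) A ^ 2 := by
  obtain ⟨U, hU, V, hV, s, hs, h⟩ := exists_svd' A
  have hV2 : V * Vᴴ = 1 := mem_unitaryGroup_iff.1 hV
  rw [schattenNorm_eq_lpSum (2 * p) hU hV hs h, ← lpSum_sq hp hs,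
    schattenNorm_eq_lpSum p hU (Unitary.star_mem hU) (fun i => sq_nonneg (s i))]
  have hd : (diagonal fun i => (s i : ℂ)) * (diagonal fun i => (s i : ℂ))ᴴ
        = diagonal fun i => ((s i ^ 2 : ℝ) : ℂ) := by
    rw [diagonal_conjTranspose, diagonal_mul_diagonal]
    congr 1; funext i; simp [sq]
  rw [h, ← hd, star_eq_conjTranspose]
  simp only [conjTranspose_mul, Matrix.mul_assoc]
  rw [← Matrix.mul_assoc V Vᴴ, hV2, Matrix.one_mul]

theorem schattenNorm_conjTranspose_mul_self {p : ℝ≥0∞} (hp : p ≠ 0) (A : Matrix ι ι ℂ) :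
    schattenNorm p (Aᴴ * A) = schattenNorm (2 * p) A ^ 2 := by
  have := schattenNorm_mul_conjTranspose_self hp Aᴴ
  rwa [conjTranspose_conjTranspose, schattenNorm_conjTranspose] at this

theorem schattenNorm_two (A : Matrix ι ι ℂ) :
    schattenNorm 2 A = ENNReal.ofReal (Aᴴ * A).trace.re ^ (1 / 2 : ℝ) := by
  have h := (isHermitian_conjTranspose_mul_self A).trace_eq_sum_eigenvalues
  unfold schattenNorm
  rw [if_neg ENNReal.ofNat_ne_top, h]
  simp only [ENNReal.toReal_ofNat]
  congr 1
  rw [Complex.re_sum, ENNReal.ofReal_sum_of_nonneg fun i _ => by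
    simpa using (posSemidef_conjTranspose_mul_self A).eigenvalues_nonneg i]
  refine Finset.sum_congr rfl fun i _ => ?_
  rw [ENNReal.ofReal_rpow_of_nonneg (singularValue_nonneg A i) zero_le_two, Real.rpow_two,
    sq_singularValue]
  rfl

end

/-! ### Trace duality and Hölder's inequality for Schatten norms. -/

section
open Matrix
open scoped Matrix.Norms.L2Operator

variable {ι : Type*} [Fintype ι] [DecidableEq ι]

theorem lpSum_one {κ : Type*} [Fintype κ] (s : κ → ℝ) :
    lpSum 1 s = ∑ i, ENNReal.ofReal (s i) := by
  simp [lpSum]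

theorem lpSum_top {κ : Type*} [Fintype κ] (s : κ → ℝ) :
    lpSum ∞ s = ⨆ i, ENNReal.ofReal (s i) := by
  simp [lpSum]

/-- Hölder's inequality with a substochastic matrix of weights. -/
theorem sum_weight_mul_le {κ : Type*} [Fintype κ] (p q : ℝ≥0∞) [ENNReal.HolderConjugate p q]
    (s t : κ → ℝ) (w : κ → κ → ℝ≥0∞) (hr : ∀ i, ∑ j, w i j ≤ 1) (hc : ∀ j, ∑ i, w i j ≤ 1) :
    ∑ i, ∑ j, w i j * (ENNReal.ofReal (s i) * ENNReal.ofReal (t j)) ≤ lpSum p s * lpSum q t := by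
  by_cases hp : p = ∞
  · subst hp
    obtain rfl : (1 : ℝ≥0∞) = q := ENNReal.HolderConjugate.unique ∞ 1 q
    rw [Finset.sum_comm, lpSum_one, lpSum_top, Finset.mul_sum]
    refine Finset.sum_le_sum fun j _ => ?_
    calc ∑ i, w i j * (ENNReal.ofReal (s i) * ENNReal.ofReal (t j))
        ≤ ∑ i, w i j * ((⨆ i, ENNReal.ofReal (s i)) * ENNReal.ofReal (t j)) := by
          gcongr with i
          exact le_iSup (fun i => ENNReal.ofReal (s i)) i
      _ ≤ _ := by
          rw [← Finset.sum_mul]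
          exact mul_le_of_le_one_left' (hc j)
  by_cases hq : q = ∞
  · subst hq
    obtain rfl : (1 : ℝ≥0∞) = p := ENNReal.HolderConjugate.unique ∞ 1 p
    rw [lpSum_one, lpSum_top, Finset.sum_mul]
    refine Finset.sum_le_sum fun i _ => ?_
    calc ∑ j, w i j * (ENNReal.ofReal (s i) * ENNReal.ofReal (t j))
        ≤ ∑ j, w i j * (ENNReal.ofReal (s i) * (⨆ i, ENNReal.ofReal (t i))) := by
          gcongr with j
          exact le_iSup (fun i => ENNReal.ofReal (t i)) j
      _ ≤ _ := by
          rw [← Finset.sum_mul]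
          exact mul_le_of_le_one_left' (hr i)
  have hpq : p.toReal.HolderConjugate q.toReal := ENNReal.HolderConjugate.toReal_of_ne_top hp hq
  have hp0 := hpq.pos
  have hq0 := hpq.symm.pos
  rw [lpSum, if_neg hp, lpSum, if_neg hq]
  -- Each weight is split as `w = w^{1/p} * w^{1/q}` and the scalar Hölder inequality is applied on
  -- `κ × κ`; row sums then collapse the first factor and column sums the second.
  have H := ENNReal.inner_le_Lp_mul_Lq (Finset.univ : Finset (κ × κ))
    (fun x => w x.1 x.2 ^ (1 / p.toReal) * ENNReal.ofReal (s x.1))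
    (fun x => w x.1 x.2 ^ (1 / q.toReal) * ENNReal.ofReal (t x.2)) hpq
  refine le_trans (le_of_eq ?_) (H.trans (mul_le_mul' ?_ ?_))
  · rw [← Finset.univ_product_univ, Finset.sum_product]
    refine Finset.sum_congr rfl fun i _ => Finset.sum_congr rfl fun j _ => ?_
    have : w i j = w i j ^ (1 / p.toReal) * w i j ^ (1 / q.toReal) := by
      rw [← ENNReal.rpow_add_of_nonneg _ _ (by positivity) (by positivity), one_div, one_div,
        hpq.inv_add_inv_eq_one, ENNReal.rpow_one]
    conv_lhs => rw [this]
    ring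
  · refine ENNReal.rpow_le_rpow ?_ (by positivity)
    rw [← Finset.univ_product_univ, Finset.sum_product]
    refine Finset.sum_le_sum fun i _ => ?_
    simp only [ENNReal.mul_rpow_of_nonneg _ _ hp0.le, ← ENNReal.rpow_mul, one_div,
      inv_mul_cancel₀ hp0.ne', ENNReal.rpow_one]
    rw [← Finset.sum_mul]
    exact mul_le_of_le_one_left' (hr i)
  · refine ENNReal.rpow_le_rpow ?_ (by positivity)
    rw [← Finset.univ_product_univ, Finset.sum_product_right]
    refine Finset.sum_le_sum fun j _ => ?_
    simp only [ENNReal.mul_rpow_of_nonneg _ _ hq0.le, ← ENNReal.rpow_mul, one_div,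
      inv_mul_cancel₀ hq0.ne', ENNReal.rpow_one]
    rw [← Finset.sum_mul]
    exact mul_le_of_le_one_left' (hc j)

/-- The `ℓ^p` norm is attained against the unit ball of the dual norm. -/
theorem exists_lpSum_dual (p q : ℝ≥0∞) [ENNReal.HolderConjugate p q]
    (s : ι → ℝ) (hs : ∀ i, 0 ≤ s i) :
    ∃ t : ι → ℝ, (∀ i, 0 ≤ t i) ∧ lpSum q t ≤ 1 ∧ ENNReal.ofReal (∑ i, s i * t i) = lpSum p s := by
  by_cases hp : p = ∞
  · subst hp
    obtain rfl : (1 : ℝ≥0∞) = q := ENNReal.HolderConjugate.unique ∞ 1 q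
    rcases isEmpty_or_nonempty ι with h | h
    · exact ⟨0, by simp, by simp [lpSum_one], by simp [lpSum_top]⟩
    obtain ⟨i, hi⟩ := exists_eq_ciSup_of_finite (f := fun i => ENNReal.ofReal (s i))
    refine ⟨Pi.single i 1, fun j => ?_, ?_, ?_⟩
    · by_cases h : j = i
      · subst h; simp
      · simp [h]
    · rw [lpSum_one, Finset.sum_eq_single i] <;> simp +contextual
    · rw [lpSum_top, ← hi, Finset.sum_eq_single i] <;> simp +contextual
  by_cases hq : q = ∞
  · subst hq
    obtain rfl : (1 : ℝ≥0∞) = p := ENNReal.HolderConjugate.unique ∞ 1 p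
    refine ⟨fun _ => 1, by simp, by simp [lpSum_top], ?_⟩
    rw [lpSum_one, ENNReal.ofReal_sum_of_nonneg fun i _ => by simpa using hs i]
    simp
  have hpq : p.toReal.HolderConjugate q.toReal := ENNReal.HolderConjugate.toReal_of_ne_top hp hq
  have hp0 := hpq.pos
  have hq0 := hpq.symm.pos
  obtain ⟨t, ht, he⟩ := (NNReal.isGreatest_Lp Finset.univ (fun i => (s i).toNNReal) hpq).1
  refine ⟨fun i => t i, fun i => (t i).2, ?_, ?_⟩
  · rw [lpSum, if_neg hq]
    simp only [ENNReal.ofReal_coe_nnreal]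
    refine ENNReal.rpow_le_one ?_ (by positivity)
    have : ∑ i, t i ^ q.toReal ≤ 1 := ht
    calc ∑ i, (t i : ℝ≥0∞) ^ q.toReal = ((∑ i, t i ^ q.toReal : NNReal) : ℝ≥0∞) := by
          push_cast
          exact Finset.sum_congr rfl fun i _ => (ENNReal.coe_rpow_of_nonneg _ hq0.le).symm
      _ ≤ 1 := by exact_mod_cast this
  · rw [lpSum, if_neg hp]
    have h1 : (∑ i, s i * (t i : ℝ)) = ((∑ i, (s i).toNNReal * t i : NNReal) : ℝ) := by
      push_cast
      exact Finset.sum_congr rfl fun i _ => by rw [Real.coe_toNNReal _ (hs i)]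
    rw [h1, ENNReal.ofReal_coe_nnreal]
    simp only at he
    rw [he, ENNReal.coe_rpow_of_nonneg _ (by positivity)]
    push_cast
    congr 1
    exact Finset.sum_congr rfl fun i _ => ENNReal.coe_rpow_of_nonneg _ hp0.le

theorem sum_sq_norm_col_le {K : Matrix ι ι ℂ} (hK : ‖K‖ ≤ 1) (j : ι) : ∑ i, ‖K i j‖ ^ 2 ≤ 1 := by
  have h := l2_opNorm_mulVec K (EuclideanSpace.single j 1)
  rw [PiLp.norm_single, norm_one, mul_one] at h
  have h2 := h.trans hK
  rw [EuclideanSpace.norm_eq, Real.sqrt_le_one] at h2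
  simpa using h2

theorem sum_sq_norm_row_le {K : Matrix ι ι ℂ} (hK : ‖K‖ ≤ 1) (i : ι) : ∑ j, ‖K i j‖ ^ 2 ≤ 1 := by
  have := sum_sq_norm_col_le (K := Kᴴ) (by rwa [l2_opNorm_conjTranspose]) i
  simpa using this

theorem norm_unitary_le {U : Matrix ι ι ℂ} (hU : U ∈ unitaryGroup ι ℂ) : ‖U‖ ≤ 1 := by
  have h : ‖Uᴴ * U‖ = ‖U‖ * ‖U‖ := l2_opNorm_conjTranspose_mul_self U
  have h1 : Uᴴ * U = 1 := mem_unitaryGroup_iff'.1 hU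
  have h2 : ‖(1 : Matrix ι ι ℂ)‖ ≤ 1 := by
    rw [← diagonal_one, l2_opNorm_diagonal]
    exact (pi_norm_le_iff_of_nonneg zero_le_one).2 fun i => by simp
  rw [h1] at h
  nlinarith [norm_nonneg U]

theorem norm_mul_le_one {K L : Matrix ι ι ℂ} (hK : ‖K‖ ≤ 1) (hL : ‖L‖ ≤ 1) : ‖K * L‖ ≤ 1 :=
  (norm_mul_le K L).trans (mul_le_one₀ hK (norm_nonneg _) hL)

/-- Hölder's inequality for Schatten norms. -/
theorem enorm_trace_le (p q : ℝ≥0∞) [ENNReal.HolderConjugate p q] {K L : Matrix ι ι ℂ}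
    (hK : ‖K‖ ≤ 1) (hL : ‖L‖ ≤ 1) (A G : Matrix ι ι ℂ) :
    ‖(K * A * L * G).trace‖ₑ ≤ schattenNorm p A * schattenNorm q G := by
  obtain ⟨U, hU, V, hV, s, hs, hA⟩ := exists_svd' A
  obtain ⟨U', hU', V', hV', t, ht, hG⟩ := exists_svd' G
  rw [schattenNorm_eq_lpSum p hU hV hs hA, schattenNorm_eq_lpSum q hU' hV' ht hG]
  set a := V' * K * U with ha
  set b := V * L * U' with hb
  have ha1 : ‖a‖ ≤ 1 := norm_mul_le_one (norm_mul_le_one (norm_unitary_le hV') hK) (norm_unitary_le hU)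
  have hb1 : ‖b‖ ≤ 1 := norm_mul_le_one (norm_mul_le_one (norm_unitary_le hV) hL) (norm_unitary_le hU')
  have htr : (K * A * L * G).trace = ∑ i, ∑ j, a j i * b i j * (s i * t j) := by
    have : (K * A * L * G).trace = ((a * diagonal (fun i => (s i : ℂ))) *
        (b * diagonal (fun i => (t i : ℂ)))).trace := by
      rw [hA, hG, ha, hb]
      rw [show K * (U * diagonal (fun i => (s i : ℂ)) * V) * L *
        (U' * diagonal (fun i => (t i : ℂ)) * V') = (K * (U * diagonal (fun i => (s i : ℂ)) * V) * L *
        (U' * diagonal (fun i => (t i : ℂ)))) * V' by simp only [Matrix.mul_assoc],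
        trace_mul_comm]
      simp only [Matrix.mul_assoc]
    rw [this, trace, Finset.sum_comm]
    refine Finset.sum_congr rfl fun j _ => ?_
    rw [diag_apply, mul_apply]
    refine Finset.sum_congr rfl fun i _ => ?_
    rw [mul_diagonal, mul_diagonal]
    ring
  -- By AM-GM, `|a j i * b i j|` is at most the mean of the squared moduli. As `a` and `b` are
  -- contractions, their rows and columns have square sum at most `1`, so these means form a
  -- substochastic matrix of weights.
  have key : ‖(K * A * L * G).trace‖ₑ ≤ ∑ i, ∑ j, ENNReal.ofReal ((‖a j i‖ ^ 2 + ‖b i j‖ ^ 2) / 2) *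
      (ENNReal.ofReal (s i) * ENNReal.ofReal (t j)) := by
    rw [htr]
    refine (enorm_sum_le _ _).trans (Finset.sum_le_sum fun i _ => ?_)
    refine (enorm_sum_le _ _).trans (Finset.sum_le_sum fun j _ => ?_)
    rw [← ENNReal.ofReal_mul (hs i), ← ENNReal.ofReal_mul (by positivity), ← ofReal_norm]
    refine ENNReal.ofReal_le_ofReal ?_
    rw [norm_mul, norm_mul, norm_mul, Complex.norm_real, Complex.norm_real,
      Real.norm_of_nonneg (hs i), Real.norm_of_nonneg (ht j)]
    have := mul_nonneg (hs i) (ht j)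
    gcongr
    nlinarith [sq_nonneg (‖a j i‖ - ‖b i j‖)]
  refine key.trans (sum_weight_mul_le p q s t _ (fun i => ?_) fun j => ?_)
  · rw [← ENNReal.ofReal_sum_of_nonneg fun j _ => by positivity]
    rw [ENNReal.ofReal_le_one, ← Finset.sum_div, Finset.sum_add_distrib]
    linarith [sum_sq_norm_col_le ha1 i, sum_sq_norm_row_le hb1 i]
  · rw [← ENNReal.ofReal_sum_of_nonneg fun j _ => by positivity]
    rw [ENNReal.ofReal_le_one, ← Finset.sum_div, Finset.sum_add_distrib]
    linarith [sum_sq_norm_col_le hb1 j, sum_sq_norm_row_le ha1 j]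

/-- The Schatten norm is attained against the unit ball of the dual norm. -/
theorem exists_schattenNorm_dual (p q : ℝ≥0∞) [ENNReal.HolderConjugate p q] (A : Matrix ι ι ℂ) :
    ∃ G : Matrix ι ι ℂ, schattenNorm q G ≤ 1 ∧ ‖(A * G).trace‖ₑ = schattenNorm p A := by
  obtain ⟨U, hU, V, hV, s, hs, hA⟩ := exists_svd' A
  obtain ⟨t, ht, ht1, he⟩ := exists_lpSum_dual p q s hs
  have hU1 : Uᴴ * U = 1 := mem_unitaryGroup_iff'.1 hU
  have hV2 : V * Vᴴ = 1 := mem_unitaryGroup_iff.1 hV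
  refine ⟨star V * diagonal (fun i => (t i : ℂ)) * star U, ?_, ?_⟩
  · rwa [schattenNorm_eq_lpSum q (Unitary.star_mem hV) (Unitary.star_mem hU) ht rfl]
  · rw [schattenNorm_eq_lpSum p hU hV hs hA, ← he, star_eq_conjTranspose, star_eq_conjTranspose]
    have : A * (Vᴴ * diagonal (fun i => (t i : ℂ)) * Uᴴ) =
        U * (diagonal (fun i => (s i : ℂ)) * diagonal (fun i => (t i : ℂ)) * Uᴴ) := by
      rw [hA]
      simp only [Matrix.mul_assoc]
      rw [← Matrix.mul_assoc V Vᴴ, hV2, Matrix.one_mul]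
    rw [this, trace_mul_comm, Matrix.mul_assoc, hU1, Matrix.mul_one, diagonal_mul_diagonal,
      trace_diagonal, ← ofReal_norm]
    have : ∑ i, (s i : ℂ) * (t i : ℂ) = ((∑ i, s i * t i : ℝ) : ℂ) := by push_cast; rfl
    rw [this, Complex.norm_real, Real.norm_of_nonneg]
    exact Finset.sum_nonneg fun i _ => mul_nonneg (hs i) (ht i)

end

/-! ### Schatten norm inequalities and Cauchy-Schwarz for positive blocks. -/

section
open Matrix
open scoped Matrix.Norms.L2Operator

variable {ι : Type*} [Fintype ι] [DecidableEq ι]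

theorem exists_holderConjugate {p : ℝ≥0∞} (hp : 1 ≤ p) : ∃ q, ENNReal.HolderConjugate p q :=
  ⟨_, ENNReal.HolderConjugate.conjExponent hp⟩

theorem norm_one_matrix_le : ‖(1 : Matrix ι ι ℂ)‖ ≤ 1 := norm_unitary_le (one_mem _)

theorem enorm_trace_mul_le (p q : ℝ≥0∞) [ENNReal.HolderConjugate p q] (A G : Matrix ι ι ℂ) :
    ‖(A * G).trace‖ₑ ≤ schattenNorm p A * schattenNorm q G := by
  simpa using enorm_trace_le p q norm_one_matrix_le norm_one_matrix_le A G

/-- A dual matrix `G` attaining the norm of the sum reduces the claim to the triangle inequality in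
`ℂ`. Homogeneity and the contraction bound use the same device. -/
theorem schattenNorm_add_le {p : ℝ≥0∞} (hp : 1 ≤ p) (A B : Matrix ι ι ℂ) :
    schattenNorm p (A + B) ≤ schattenNorm p A + schattenNorm p B := by
  obtain ⟨q, hq⟩ := exists_holderConjugate hp
  obtain ⟨G, hG, h⟩ := exists_schattenNorm_dual p q (A + B)
  rw [← h, Matrix.add_mul, trace_add]
  refine (enorm_add_le _ _).trans (add_le_add ?_ ?_)
  · exact (enorm_trace_mul_le p q A G).trans (mul_le_of_le_one_right' hG)
  · exact (enorm_trace_mul_le p q B G).trans (mul_le_of_le_one_right' hG)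

theorem schattenNorm_smul {p : ℝ≥0∞} (hp : 1 ≤ p) (c : ℂ) (A : Matrix ι ι ℂ) :
    schattenNorm p (c • A) = ‖c‖ₑ * schattenNorm p A := by
  have hle : ∀ (c : ℂ) (A : Matrix ι ι ℂ), schattenNorm p (c • A) ≤ ‖c‖ₑ * schattenNorm p A := by
    intro c A
    obtain ⟨q, hq⟩ := exists_holderConjugate hp
    obtain ⟨G, hG, h⟩ := exists_schattenNorm_dual p q (c • A)
    rw [← h, Matrix.smul_mul, trace_smul, smul_eq_mul, enorm_mul]
    gcongr
    exact (enorm_trace_mul_le p q A G).trans (mul_le_of_le_one_right' hG)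
  refine le_antisymm (hle c A) ?_
  rcases eq_or_ne c 0 with rfl | hc
  · simp
  calc ‖c‖ₑ * schattenNorm p A = ‖c‖ₑ * schattenNorm p (c⁻¹ • c • A) := by
        rw [inv_smul_smul₀ hc]
    _ ≤ ‖c‖ₑ * (‖c⁻¹‖ₑ * schattenNorm p (c • A)) := by gcongr; exact hle _ _
    _ = schattenNorm p (c • A) := by
        rw [← mul_assoc, ← enorm_mul, mul_inv_cancel₀ hc, enorm_one, one_mul]

/-- Schatten norms decrease under multiplication by contractions. -/
theorem schattenNorm_contraction_le {p : ℝ≥0∞} (hp : 1 ≤ p) {K L : Matrix ι ι ℂ}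
    (hK : ‖K‖ ≤ 1) (hL : ‖L‖ ≤ 1) (A : Matrix ι ι ℂ) :
    schattenNorm p (K * A * L) ≤ schattenNorm p A := by
  obtain ⟨q, hq⟩ := exists_holderConjugate hp
  obtain ⟨G, hG, h⟩ := exists_schattenNorm_dual p q (K * A * L)
  rw [← h]
  exact (enorm_trace_le p q hK hL A G).trans (mul_le_of_le_one_right' hG)

theorem ofReal_le_lpSum {κ : Type*} [Fintype κ] {p : ℝ≥0∞} (hp : p ≠ 0) (s : κ → ℝ) (i : κ) :
    ENNReal.ofReal (s i) ≤ lpSum p s := by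
  unfold lpSum
  split_ifs with h
  · exact le_iSup (fun i => ENNReal.ofReal (s i)) i
  · have hp' := ENNReal.toReal_pos hp h
    rw [one_div, ENNReal.le_rpow_inv_iff hp']
    exact Finset.single_le_sum (f := fun i => ENNReal.ofReal (s i) ^ p.toReal)
      (fun _ _ => zero_le) (Finset.mem_univ i)

theorem norm_diagonal_le {s : ι → ℂ} {b : ℝ} (hb : 0 ≤ b) (h : ∀ i, ‖s i‖ ≤ b) :
    ‖diagonal s‖ ≤ b := by
  rw [l2_opNorm_diagonal]
  exact (pi_norm_le_iff_of_nonneg hb).2 h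

theorem norm_unitary_mul_mul_le {U V D : Matrix ι ι ℂ} (hU : U ∈ unitaryGroup ι ℂ)
    (hV : V ∈ unitaryGroup ι ℂ) : ‖U * D * V‖ ≤ ‖D‖ := by
  calc ‖U * D * V‖ ≤ ‖U‖ * ‖D‖ * ‖V‖ :=
        (norm_mul_le _ _).trans (mul_le_mul_of_nonneg_right (norm_mul_le _ _) (norm_nonneg _))
    _ ≤ 1 * ‖D‖ * 1 := by gcongr <;> apply norm_unitary_le <;> assumption
    _ = ‖D‖ := by ring

theorem enorm_le_schattenNorm {p : ℝ≥0∞} (hp : p ≠ 0) (A : Matrix ι ι ℂ) :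
    ‖A‖ₑ ≤ schattenNorm p A := by
  obtain ⟨U, hU, V, hV, s, hs, hA⟩ := exists_svd' A
  rw [schattenNorm_eq_lpSum p hU hV hs hA]
  by_cases htop : lpSum p s = ∞
  · simp [htop]
  have h1 : ‖A‖ ≤ (lpSum p s).toReal := by
    rw [hA]
    refine (norm_unitary_mul_mul_le hU hV).trans (norm_diagonal_le ENNReal.toReal_nonneg fun i => ?_)
    rw [Complex.norm_real, Real.norm_of_nonneg (hs i), ← ENNReal.ofReal_le_iff_le_toReal htop]
    exact ofReal_le_lpSum hp s i
  rw [← ofReal_norm]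
  exact ENNReal.ofReal_le_of_le_toReal h1

theorem norm_le_one_of_schattenNorm_le_one {p : ℝ≥0∞} (hp : p ≠ 0) {A : Matrix ι ι ℂ}
    (hA : schattenNorm p A ≤ 1) : ‖A‖ ≤ 1 := by
  have := (enorm_le_schattenNorm hp A).trans hA
  rwa [← ofReal_norm, ENNReal.ofReal_le_one] at this

theorem norm_entry_le {K : Matrix ι ι ℂ} (hK : ‖K‖ ≤ 1) (i j : ι) : ‖K i j‖ ≤ 1 := by
  have h1 := sum_sq_norm_col_le hK j
  have h2 := Finset.single_le_sum (f := fun i => ‖K i j‖ ^ 2) (fun _ _ => sq_nonneg _)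
    (Finset.mem_univ i)
  have h3 : ‖K i j‖ ^ 2 ≤ 1 := h2.trans h1
  exact (sq_le_one_iff₀ (norm_nonneg _)).1 h3

/-- The dual matrix has operator norm at most `1`, hence entries of modulus at most `1`. This gives
finiteness of Schatten norms and the modulus of continuity used in the compactness argument. -/
theorem schattenNorm_le_sum {p : ℝ≥0∞} (hp : 1 ≤ p) (A : Matrix ι ι ℂ) :
    schattenNorm p A ≤ ∑ i, ∑ j, ‖A i j‖ₑ := by
  obtain ⟨q, hq⟩ := exists_holderConjugate hp
  obtain ⟨G, hG, h⟩ := exists_schattenNorm_dual p q A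
  have hq0 : q ≠ 0 := ENNReal.HolderConjugate.ne_zero q p
  have hG1 := norm_le_one_of_schattenNorm_le_one hq0 hG
  rw [← h, trace]
  refine (enorm_sum_le _ _).trans (Finset.sum_le_sum fun i _ => ?_)
  rw [diag_apply, mul_apply]
  refine (enorm_sum_le _ _).trans (Finset.sum_le_sum fun j _ => ?_)
  rw [enorm_mul]
  refine mul_le_of_le_one_right' ?_
  rw [← ofReal_norm, ENNReal.ofReal_le_one]
  exact norm_entry_le hG1 j i

theorem schattenNorm_ne_top {p : ℝ≥0∞} (hp : 1 ≤ p) (A : Matrix ι ι ℂ) :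
    schattenNorm p A ≠ ∞ :=
  ne_top_of_le_ne_top (by
    refine ENNReal.sum_ne_top.2 fun i _ => ENNReal.sum_ne_top.2 fun j _ => enorm_ne_top)
    (schattenNorm_le_sum hp A)

theorem schattenNorm_ne_zero {p : ℝ≥0∞} (hp : p ≠ 0) {A : Matrix ι ι ℂ} (hA : A ≠ 0) :
    schattenNorm p A ≠ 0 := fun h => by
  have := enorm_le_schattenNorm hp A
  rw [h, nonpos_iff_eq_zero, enorm_eq_zero] at this
  exact hA this

theorem schattenNorm_zero {p : ℝ≥0∞} (hp : 1 ≤ p) : schattenNorm p (0 : Matrix ι ι ℂ) = 0 := by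
  simpa using schattenNorm_smul hp 0 (0 : Matrix ι ι ℂ)

/-- Schatten norms are bimodular over the operator norm. -/
theorem schattenNorm_mul_mul_le {p : ℝ≥0∞} (hp : 1 ≤ p) (K A L : Matrix ι ι ℂ) :
    schattenNorm p (K * A * L) ≤ ‖K‖ₑ * schattenNorm p A * ‖L‖ₑ := by
  rcases eq_or_ne K 0 with rfl | hK
  · simp [schattenNorm_zero hp]
  rcases eq_or_ne L 0 with rfl | hL
  · simp [schattenNorm_zero hp]
  have hK' : (‖K‖ : ℂ) ≠ 0 := by exact_mod_cast norm_ne_zero_iff.2 hK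
  have hL' : (‖L‖ : ℂ) ≠ 0 := by exact_mod_cast norm_ne_zero_iff.2 hL
  have h1 : K * A * L = (‖K‖ : ℂ) • (‖L‖ : ℂ) •
      (((‖K‖ : ℂ)⁻¹ • K) * A * ((‖L‖ : ℂ)⁻¹ • L)) := by
    simp only [Matrix.smul_mul, Matrix.mul_smul, smul_smul]
    rw [show (‖K‖ : ℂ) * ((‖L‖ : ℂ) * ((‖L‖ : ℂ)⁻¹ * (‖K‖ : ℂ)⁻¹)) = 1 by field_simp, one_smul]
  have hn : ∀ M : Matrix ι ι ℂ, M ≠ 0 → ‖(‖M‖ : ℂ)⁻¹ • M‖ ≤ 1 := by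
    intro M hM
    rw [norm_smul, norm_inv, Complex.norm_real, norm_norm, inv_mul_cancel₀ (norm_ne_zero_iff.2 hM)]
  have he : ∀ M : Matrix ι ι ℂ, ‖(‖M‖ : ℂ)‖ₑ = ‖M‖ₑ := by
    intro M
    rw [← ofReal_norm, Complex.norm_real, norm_norm, ofReal_norm]
  rw [h1, schattenNorm_smul hp, schattenNorm_smul hp, he, he]
  calc _ ≤ ‖K‖ₑ * (‖L‖ₑ * schattenNorm p A) := by
        gcongr
        exact schattenNorm_contraction_le hp (hn K hK) (hn L hL) A
    _ = _ := by ring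

/-- The Cauchy-Schwarz inequality for the Schatten norms of the blocks of a positive
semidefinite block matrix. -/
theorem schattenNorm_sq_le_of_posSemidef {p : ℝ≥0∞} (hp : 1 ≤ p) {X Y W : Matrix ι ι ℂ}
    (h : (fromBlocks X Y Yᴴ W).PosSemidef) :
    schattenNorm p Y ^ 2 ≤ schattenNorm p X * schattenNorm p W := by
  obtain ⟨q, hq⟩ := exists_holderConjugate hp
  obtain ⟨G, hG, hYG⟩ := exists_schattenNorm_dual p q Y
  obtain ⟨U, hU, V, hV, t, ht, hGs⟩ := exists_svd' G
  rw [schattenNorm_eq_lpSum q hU hV ht hGs] at hG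
  set D : Matrix ι ι ℂ := diagonal (fun i => (t i : ℂ)) with hD
  set R : Matrix ι ι ℂ := diagonal (fun i => (Real.sqrt (t i) : ℂ)) with hR
  have hRR : R * R = D := by
    rw [hR, diagonal_mul_diagonal, hD]
    congr 1; funext i
    rw [← Complex.ofReal_mul, Real.mul_self_sqrt (ht i)]
  have hRH : Rᴴ = R := by
    rw [hR, diagonal_conjTranspose]
    congr 1; funext i; simp
  obtain ⟨c, hc, hcz⟩ : ∃ c : ℂ, ‖c‖ = 1 ∧ c * (Y * G).trace = (‖(Y * G).trace‖ : ℂ) := by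
    obtain ⟨c, hc, hcz⟩ := RCLike.exists_norm_mul_eq_self (Y * G).trace
    refine ⟨starRingEnd ℂ c, by simpa using hc, ?_⟩
    conv_lhs => rw [← hcz]
    rw [← mul_assoc, ← Complex.normSq_eq_conj_mul_self, Complex.normSq_eq_norm_sq, hc]
    simp
  have hcc : starRingEnd ℂ c * c = 1 := by
    rw [← Complex.normSq_eq_conj_mul_self, Complex.normSq_eq_norm_sq, hc]; simp
  set x := ‖(X * (Vᴴ * D * V)).trace‖
  set w := ‖(W * (U * D * Uᴴ)).trace‖
  set y := ‖(Y * G).trace‖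
  -- The block matrix is compressed by the column with blocks `l Vᴴ √D` and `-c U √D`, where `G = U
  -- D V` and the phase `c` makes `Tr(Y G)` nonnegative. The trace of the result is a quadratic in
  -- `l` that is never negative, so its discriminant gives `y² ≤ x w`; the matrices `Vᴴ D V` and `U
  -- D Uᴴ` have the same dual norm as `G`.
  have key : ∀ l : ℝ, 0 ≤ x * (l * l) + (-2 * y) * l + w := by
    intro l
    set v1 : Matrix ι ι ℂ := (l : ℂ) • (Vᴴ * R)
    set v2 : Matrix ι ι ℂ := (-c) • (U * R)
    have h1 := (h.conjTranspose_mul_mul_same (fromRows v1 v2)).trace_nonneg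
    have e1 : (fromRows v1 v2)ᴴ * fromBlocks X Y Yᴴ W * fromRows v1 v2 =
        v1ᴴ * X * v1 + v2ᴴ * Yᴴ * v1 + (v1ᴴ * Y * v2 + v2ᴴ * W * v2) := by
      rw [conjTranspose_fromRows_eq_fromCols_conjTranspose, fromCols_mul_fromBlocks,
        fromCols_mul_fromRows, Matrix.add_mul, Matrix.add_mul]
    have t1 : (v1ᴴ * X * v1).trace = (l : ℂ) * l * (X * (Vᴴ * D * V)).trace := by
      rw [trace_mul_comm, ← Matrix.mul_assoc, trace_mul_comm]
      simp only [v1, conjTranspose_smul, conjTranspose_mul, hRH, conjTranspose_conjTranspose,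
        Matrix.smul_mul, Matrix.mul_smul, trace_smul, ← hRR, Matrix.mul_assoc, smul_eq_mul]
      simp
      ring
    have t2 : (v2ᴴ * W * v2).trace = (W * (U * D * Uᴴ)).trace := by
      rw [trace_mul_comm, ← Matrix.mul_assoc, trace_mul_comm]
      simp only [v2, conjTranspose_smul, conjTranspose_mul, hRH,
        Matrix.smul_mul, Matrix.mul_smul, trace_smul, ← hRR, Matrix.mul_assoc, smul_eq_mul]
      rw [← mul_assoc]
      simp [hcc]
    have t3 : (v1ᴴ * Y * v2).trace = -(l * y : ℂ) := by
      rw [← hcz, hGs, trace_mul_comm, ← Matrix.mul_assoc, trace_mul_comm]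
      simp only [v1, v2, conjTranspose_smul, conjTranspose_mul, hRH, conjTranspose_conjTranspose,
        Matrix.smul_mul, Matrix.mul_smul, trace_smul, ← hRR, Matrix.mul_assoc, smul_eq_mul]
      simp
    have t4 : (v2ᴴ * Yᴴ * v1).trace = -(l * y : ℂ) := by
      have : v2ᴴ * Yᴴ * v1 = (v1ᴴ * Y * v2)ᴴ := by
        simp [Matrix.mul_assoc]
      rw [this, trace_conjTranspose, t3]
      simp
    rw [e1, trace_add, trace_add, trace_add, t1, t2, t3, t4] at h1
    have h2 := (Complex.le_def.1 h1).1
    have h3 := Complex.re_le_norm (X * (Vᴴ * D * V)).trace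
    have h4 := Complex.re_le_norm (W * (U * D * Uᴴ)).trace
    rw [← Complex.ofReal_mul, ← Complex.ofReal_mul, ← Complex.ofReal_neg] at h2
    simp only [Complex.zero_re, Complex.add_re, Complex.re_ofReal_mul, Complex.ofReal_re] at h2
    nlinarith [mul_le_mul_of_nonneg_left h3 (mul_self_nonneg l)]
  have hdis := discrim_le_zero key
  have hxw : y ^ 2 ≤ x * w := by
    rw [discrim] at hdis
    nlinarith
  have hx : ENNReal.ofReal x ≤ schattenNorm p X := by
    rw [ofReal_norm]
    refine (enorm_trace_mul_le p q X _).trans (mul_le_of_le_one_right' ?_)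
    rwa [schattenNorm_eq_lpSum q (Unitary.star_mem hV) hV ht (A := Vᴴ * D * V) rfl]
  have hw : ENNReal.ofReal w ≤ schattenNorm p W := by
    rw [ofReal_norm]
    refine (enorm_trace_mul_le p q W _).trans (mul_le_of_le_one_right' ?_)
    rwa [schattenNorm_eq_lpSum q hU (Unitary.star_mem hU) ht (A := U * D * Uᴴ) rfl]
  rw [← hYG, ← ofReal_norm, ← ENNReal.ofReal_pow (norm_nonneg _)]
  calc _ ≤ ENNReal.ofReal (x * w) := ENNReal.ofReal_le_ofReal hxw
    _ = ENNReal.ofReal x * ENNReal.ofReal w := ENNReal.ofReal_mul (norm_nonneg _)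
    _ ≤ _ := mul_le_mul' hx hw

/-- The product `A * B` is the off-diagonal corner of the Gram matrix of the block column with
entries `A` and `Bᴴ`, whose diagonal corners are `A * Aᴴ` and `Bᴴ * B`. -/
theorem schattenNorm_mul_le {p : ℝ≥0∞} (hp : 1 ≤ p) (A B : Matrix ι ι ℂ) :
    schattenNorm p (A * B) ≤ schattenNorm (2 * p) A * schattenNorm (2 * p) B := by
  have hp0 : p ≠ 0 := (zero_lt_one.trans_le hp).ne'
  have h : (fromBlocks (A * Aᴴ) (A * B) (A * B)ᴴ (Bᴴ * B)).PosSemidef := by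
    have := posSemidef_self_mul_conjTranspose (fromRows A Bᴴ)
    rwa [conjTranspose_fromRows_eq_fromCols_conjTranspose, fromRows_mul_fromCols,
      conjTranspose_conjTranspose, ← conjTranspose_mul] at this
  have := schattenNorm_sq_le_of_posSemidef hp h
  rw [schattenNorm_mul_conjTranspose_self hp0, schattenNorm_conjTranspose_mul_self hp0,
    ← mul_pow] at this
  exact (ENNReal.pow_le_pow_left_iff two_ne_zero).1 this

end

/-! ### Bounded analytic functions on a strip and the three lines theorem. -/

section
open Matrix
open scoped Matrix.Norms.L2Operator

/-- Entire functions bounded on the strip `0 ≤ re z ≤ 1`. -/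
def StripBounded (f : ℂ → ℂ) : Prop :=
  Differentiable ℂ f ∧ ∃ K : ℝ, ∀ z : ℂ, 0 ≤ z.re → z.re ≤ 1 → ‖f z‖ ≤ K

theorem StripBounded.const (c : ℂ) : StripBounded fun _ => c :=
  ⟨differentiable_const c, ‖c‖, fun _ _ _ => le_rfl⟩

theorem StripBounded.mul {f g : ℂ → ℂ} (hf : StripBounded f) (hg : StripBounded g) :
    StripBounded fun z => f z * g z := by
  obtain ⟨hf, K, hK⟩ := hf
  obtain ⟨hg, L, hL⟩ := hg
  refine ⟨hf.mul hg, K * L, fun z h0 h1 => ?_⟩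
  rw [norm_mul]
  exact mul_le_mul (hK z h0 h1) (hL z h0 h1) (norm_nonneg _) ((norm_nonneg _).trans (hK z h0 h1))

theorem StripBounded.sum {κ : Type*} (t : Finset κ) {f : κ → ℂ → ℂ}
    (hf : ∀ i ∈ t, StripBounded (f i)) : StripBounded fun z => ∑ i ∈ t, f i z := by
  choose! hd K hK using hf
  refine ⟨Differentiable.fun_sum hd, ∑ i ∈ t, K i, fun z h0 h1 => ?_⟩
  exact (norm_sum_le _ _).trans (Finset.sum_le_sum fun i hi => hK i hi z h0 h1)

/-- The complex power of a nonnegative real number, with all powers of `0` equal to `0`. -/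
noncomputable def cpow0 (s : ℝ) (w : ℂ) : ℂ := if s = 0 then 0 else (s : ℂ) ^ w

theorem norm_cpow0 {s : ℝ} (hs : 0 < s) (w : ℂ) : ‖cpow0 s w‖ = s ^ w.re := by
  rw [cpow0, if_neg hs.ne', Complex.norm_cpow_eq_rpow_re_of_pos hs]

theorem norm_cpow0_le_one {s : ℝ} (hs : 0 ≤ s) {w : ℂ} (hw : w.re = 0) : ‖cpow0 s w‖ ≤ 1 := by
  rcases hs.eq_or_lt with rfl | hs
  · simp [cpow0]
  · rw [norm_cpow0 hs, hw, Real.rpow_zero]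

theorem cpow0_ofReal {s : ℝ} (hs : 0 ≤ s) {x : ℝ} (hx : x ≠ 0) : cpow0 s x = (s ^ x : ℝ) := by
  rcases hs.eq_or_lt with rfl | hs
  · simp [cpow0, Real.zero_rpow hx]
  · rw [cpow0, if_neg hs.ne', Complex.ofReal_cpow hs.le]

theorem cpow0_add (s : ℝ) (z w : ℂ) : cpow0 s (z + w) = cpow0 s z * cpow0 s w := by
  unfold cpow0
  split_ifs with h
  · simp
  · rw [Complex.cpow_add _ _ (by exact_mod_cast h)]

/-- Setting every power of `0` to `0` keeps each entry entire, so powers of singular matrices can be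
interpolated too. -/
theorem StripBounded.cpow0 {s : ℝ} (hs : 0 ≤ s) (a b : ℝ) :
    StripBounded fun z => cpow0 s (a * z + b) := by
  rcases hs.eq_or_lt with rfl | hs
  · simpa [CBNorm.cpow0] using StripBounded.const 0
  have hs' : (s : ℂ) ≠ 0 := by exact_mod_cast hs.ne'
  refine ⟨?_, Real.exp (|Real.log s| * (|a| + |b|)), fun z h0 h1 => ?_⟩
  · simp only [CBNorm.cpow0, if_neg hs.ne']
    intro z
    exact DifferentiableAt.const_cpow (by fun_prop) (Or.inl hs')
  · rw [norm_cpow0 hs, Real.rpow_def_of_pos hs]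
    refine Real.exp_le_exp.2 ((le_abs_self _).trans ?_)
    rw [abs_mul]
    gcongr
    simp only [Complex.add_re, Complex.re_ofReal_mul, Complex.ofReal_re]
    refine (abs_add_le _ _).trans (add_le_add ?_ le_rfl)
    rw [abs_mul, abs_of_nonneg h0]
    exact mul_le_of_le_one_right (abs_nonneg a) h1

/-- Matrix valued functions with entries in `StripBounded`. -/
def MatStripBounded {ι : Type*} (F : ℂ → Matrix ι ι ℂ) : Prop :=
  ∀ i j, StripBounded fun z => F z i j

theorem MatStripBounded.const {ι : Type*} (A : Matrix ι ι ℂ) : MatStripBounded fun _ => A :=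
  fun i j => StripBounded.const (A i j)

theorem MatStripBounded.mul {ι : Type*} [Fintype ι] {F G : ℂ → Matrix ι ι ℂ} (hF : MatStripBounded F)
    (hG : MatStripBounded G) : MatStripBounded fun z => F z * G z := fun i j => by
  simp only [mul_apply]
  exact StripBounded.sum _ fun k _ => (hF i k).mul (hG k j)

theorem MatStripBounded.diagonal {ι : Type*} [DecidableEq ι] {f : ι → ℂ → ℂ} (hf : ∀ i, StripBounded (f i)) :
    MatStripBounded fun z => diagonal fun i => f i z := fun i j => by
  by_cases h : i = j
  · subst h; simpa using hf i
  · simpa [diagonal_apply_ne _ h] using StripBounded.const 0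

theorem MatStripBounded.trace {ι : Type*} [Fintype ι] {F : ℂ → Matrix ι ι ℂ} (hF : MatStripBounded F) :
    StripBounded fun z => (F z).trace :=
  StripBounded.sum _ fun i _ => hF i i

/-- Hadamard's three lines theorem, with the same bound on both edges. -/
theorem StripBounded.norm_le {f : ℂ → ℂ} (hf : StripBounded f) {M : ℝ}
    (h0 : ∀ z : ℂ, z.re = 0 → ‖f z‖ ≤ M) (h1 : ∀ z : ℂ, z.re = 1 → ‖f z‖ ≤ M)
    {z : ℂ} (hz0 : 0 ≤ z.re) (hz1 : z.re ≤ 1) : ‖f z‖ ≤ M := by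
  obtain ⟨hd, K, hK⟩ := hf
  have hM : 0 ≤ M := (norm_nonneg _).trans (h0 0 rfl)
  have := Complex.HadamardThreeLines.norm_le_interp_of_mem_verticalClosedStrip₀₁' f (z := z)
    (a := M) (b := M) ⟨hz0, hz1⟩ hd.diffContOnCl
    ⟨K, by rintro _ ⟨z, hz, rfl⟩; exact hK z hz.1 hz.2⟩ h0 h1
  refine this.trans (le_of_eq ?_)
  -- The interpolated bound is a product of two powers of `M`. When `M = 0`, the convention `0 ^ 0 =
  -- 1` affects one of them at an edge, and the other supplies the zero.
  rcases hM.eq_or_lt with rfl | hM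
  · by_cases h : z.re = 0
    · simp [h]
    · simp [Real.zero_rpow h]
  · rw [← Real.rpow_add hM]
    simp

theorem StripBounded.enorm_le {f : ℂ → ℂ} (hf : StripBounded f) {M : ℝ≥0∞}
    (h0 : ∀ z : ℂ, z.re = 0 → ‖f z‖ₑ ≤ M) (h1 : ∀ z : ℂ, z.re = 1 → ‖f z‖ₑ ≤ M)
    {z : ℂ} (hz0 : 0 ≤ z.re) (hz1 : z.re ≤ 1) : ‖f z‖ₑ ≤ M := by
  rcases eq_or_ne M ∞ with rfl | hM
  · exact le_top
  have key : ∀ w : ℂ, ‖f w‖ₑ ≤ M ↔ ‖f w‖ ≤ M.toReal := fun w => by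
    rw [← ofReal_norm, ENNReal.ofReal_le_iff_le_toReal hM]
  simp only [key] at *
  exact hf.norm_le h0 h1 hz0 hz1

end

/-! ### Amplifications, the `(∞,p)` norm, and its Cauchy-Schwarz inequality. -/

section
open Matrix
open scoped Matrix.Norms.L2Operator

variable {d n : ℕ}

theorem ampl_mul (A B : Matrix (Fin d) (Fin d) ℂ) : ampl n (A * B) = ampl n A * ampl n B := by
  simp [ampl, ← mul_kronecker_mul]

theorem ampl_one : ampl n (1 : Matrix (Fin d) (Fin d) ℂ) = 1 := one_kronecker_one

theorem ampl_conjTranspose (A : Matrix (Fin d) (Fin d) ℂ) : (ampl n A)ᴴ = ampl n Aᴴ := by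
  simp [ampl, conjTranspose_kronecker]

theorem ampl_diagonal (s : Fin d → ℂ) :
    ampl n (diagonal s) = diagonal fun x : Fin d × Fin n => s x.1 := by
  rw [ampl, ← diagonal_one, diagonal_kronecker_diagonal]
  simp

theorem ampl_mem_unitaryGroup {U : Matrix (Fin d) (Fin d) ℂ} (hU : U ∈ unitaryGroup (Fin d) ℂ) :
    ampl n U ∈ unitaryGroup (Fin d × Fin n) ℂ := by
  rw [mem_unitaryGroup_iff, star_eq_conjTranspose, ampl_conjTranspose, ← ampl_mul,
    ← star_eq_conjTranspose, mem_unitaryGroup_iff.1 hU, ampl_one]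

theorem norm_ampl_le (A : Matrix (Fin d) (Fin d) ℂ) : ‖ampl n A‖ ≤ ‖A‖ := by
  obtain ⟨U, hU, V, hV, s, hs, hA⟩ := exists_svd' A
  have h1 : diagonal (fun i => (s i : ℂ)) = star U * A * star V := by
    rw [hA, show star U * (U * diagonal (fun i => (s i : ℂ)) * V) * star V =
      (star U * U) * diagonal (fun i => (s i : ℂ)) * (V * star V) by simp only [Matrix.mul_assoc],
      mem_unitaryGroup_iff'.1 hU, mem_unitaryGroup_iff.1 hV, Matrix.one_mul, Matrix.mul_one]
  have h2 : ‖diagonal (fun i => (s i : ℂ))‖ ≤ ‖A‖ := by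
    rw [h1]
    exact norm_unitary_mul_mul_le (Unitary.star_mem hU) (Unitary.star_mem hV)
  rw [l2_opNorm_diagonal] at h2
  conv_lhs => rw [hA, ampl_mul, ampl_mul, ampl_diagonal]
  exact (norm_unitary_mul_mul_le (ampl_mem_unitaryGroup hU) (ampl_mem_unitaryGroup hV)).trans
    (norm_diagonal_le (norm_nonneg _) fun x => (norm_le_pi_norm (fun i => (s i : ℂ)) x.1).trans h2)

theorem one_le_two_mul {p : ℝ≥0∞} (hp : 1 ≤ p) : 1 ≤ 2 * p :=
  hp.trans (by rw [two_mul]; exact le_self_add)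

theorem schattenNorm_le_normInf {p : ℝ≥0∞} (hp : 1 ≤ p)
    (Y : Matrix (Fin d × Fin n) (Fin d × Fin n) ℂ) (C D : Matrix (Fin d) (Fin d) ℂ) :
    schattenNorm p (ampl n C * Y * ampl n D) ≤
      schattenNorm (2 * p) C * schattenNorm (2 * p) D * normInf p Y := by
  rcases eq_or_ne C 0 with rfl | hC
  · simp [ampl, schattenNorm_zero hp]
  rcases eq_or_ne D 0 with rfl | hD
  · simp [ampl, schattenNorm_zero hp]
  have hp2 := one_le_two_mul hp
  have hp0 : 2 * p ≠ 0 := (zero_lt_one.trans_le hp2).ne'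
  rw [mul_comm, ← ENNReal.div_le_iff
    (mul_ne_zero (schattenNorm_ne_zero hp0 hC) (schattenNorm_ne_zero hp0 hD))
    (ENNReal.mul_ne_top (schattenNorm_ne_top hp2 C) (schattenNorm_ne_top hp2 D))]
  exact le_iSup₂_of_le C D (le_iSup₂_of_le hC hD le_rfl)

theorem normInf_le {p : ℝ≥0∞} {Y : Matrix (Fin d × Fin n) (Fin d × Fin n) ℂ} {c : ℝ≥0∞}
    (h : ∀ C D : Matrix (Fin d) (Fin d) ℂ, schattenNorm p (ampl n C * Y * ampl n D) ≤
      schattenNorm (2 * p) C * schattenNorm (2 * p) D * c) : normInf p Y ≤ c := by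
  refine iSup₂_le fun C D => iSup₂_le fun hC hD => ENNReal.div_le_of_le_mul ?_
  rw [mul_comm c]
  exact h C D

theorem normInf_conjTranspose_le {p : ℝ≥0∞} (hp : 1 ≤ p)
    (Y : Matrix (Fin d × Fin n) (Fin d × Fin n) ℂ) : normInf p Yᴴ ≤ normInf p Y := by
  refine normInf_le fun C D => ?_
  have h := schattenNorm_le_normInf hp Y Dᴴ Cᴴ
  rw [← schattenNorm_conjTranspose] at h
  simp only [conjTranspose_mul, ampl_conjTranspose, conjTranspose_conjTranspose,
    schattenNorm_conjTranspose] at h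
  rwa [← Matrix.mul_assoc, mul_comm (schattenNorm _ D)] at h

theorem normInf_contraction_le {p : ℝ≥0∞} (hp : 1 ≤ p) {K L : Matrix (Fin d) (Fin d) ℂ}
    (hK : ‖K‖ ≤ 1) (hL : ‖L‖ ≤ 1) (Y : Matrix (Fin d × Fin n) (Fin d × Fin n) ℂ) :
    normInf p (ampl n K * Y * ampl n L) ≤ normInf p Y := by
  refine normInf_le fun C D => ?_
  have h := schattenNorm_le_normInf hp Y (C * K) (L * D)
  simp only [ampl_mul, Matrix.mul_assoc] at h ⊢
  refine h.trans ?_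
  have hp2 := one_le_two_mul hp
  have h1 := schattenNorm_contraction_le hp2 norm_one_matrix_le hK C
  have h2 := schattenNorm_contraction_le hp2 hL norm_one_matrix_le D
  rw [Matrix.one_mul] at h1
  rw [Matrix.mul_one] at h2
  gcongr

/-- Tensoring with the identity does not increase the operator norm, which is itself dominated by
the Schatten `2p`-norm. -/
theorem normInf_le_schattenNorm {p : ℝ≥0∞} (hp : 1 ≤ p)
    (Y : Matrix (Fin d × Fin n) (Fin d × Fin n) ℂ) : normInf p Y ≤ schattenNorm p Y := by
  refine normInf_le fun C D => (schattenNorm_mul_mul_le hp _ _ _).trans ?_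
  have hp0 : 2 * p ≠ 0 := (zero_lt_one.trans_le (one_le_two_mul hp)).ne'
  have h : ∀ C : Matrix (Fin d) (Fin d) ℂ, ‖ampl n C‖ₑ ≤ schattenNorm (2 * p) C := fun C =>
    (enorm_le_iff_norm_le.2 (norm_ampl_le C)).trans (enorm_le_schattenNorm hp0 C)
  calc _ ≤ schattenNorm (2 * p) C * schattenNorm p Y * schattenNorm (2 * p) D := by
        gcongr <;> exact h _
    _ = _ := by ring

theorem normInf_ne_top {p : ℝ≥0∞} (hp : 1 ≤ p)
    (Y : Matrix (Fin d × Fin n) (Fin d × Fin n) ℂ) : normInf p Y ≠ ∞ :=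
  ne_top_of_le_ne_top (schattenNorm_ne_top hp Y) (normInf_le_schattenNorm hp Y)

theorem normInf_add_le {p : ℝ≥0∞} (hp : 1 ≤ p)
    (X Y : Matrix (Fin d × Fin n) (Fin d × Fin n) ℂ) :
    normInf p (X + Y) ≤ normInf p X + normInf p Y := by
  refine normInf_le fun C D => ?_
  rw [Matrix.mul_add, Matrix.add_mul, mul_add]
  exact (schattenNorm_add_le hp _ _).trans
    (add_le_add (schattenNorm_le_normInf hp X C D) (schattenNorm_le_normInf hp Y C D))

theorem normInf_smul_le {p : ℝ≥0∞} (hp : 1 ≤ p) (c : ℂ)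
    (Y : Matrix (Fin d × Fin n) (Fin d × Fin n) ℂ) :
    normInf p (c • Y) ≤ ‖c‖ₑ * normInf p Y := by
  refine normInf_le fun C D => ?_
  rw [Matrix.mul_smul, Matrix.smul_mul, schattenNorm_smul hp, mul_left_comm]
  gcongr
  exact schattenNorm_le_normInf hp Y C D

theorem PosSemidef.fromBlocks_conj {κ : Type*} [Fintype κ] [DecidableEq κ]
    {X Y W : Matrix κ κ ℂ} (h : (fromBlocks X Y Yᴴ W).PosSemidef) (a b : Matrix κ κ ℂ) :
    (fromBlocks (a * X * aᴴ) (a * Y * b) (a * Y * b)ᴴ (bᴴ * W * b)).PosSemidef := by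
  have := h.mul_mul_conjTranspose_same (fromBlocks a 0 0 bᴴ)
  rw [fromBlocks_conjTranspose, fromBlocks_multiply, fromBlocks_multiply] at this
  simpa [Matrix.mul_assoc] using this

/-- The Cauchy-Schwarz inequality for `normInf` of the blocks of a positive semidefinite block
matrix. -/
theorem normInf_sq_le_of_posSemidef {p : ℝ≥0∞} (hp : 1 ≤ p)
    {X Y W : Matrix (Fin d × Fin n) (Fin d × Fin n) ℂ}
    (h : (fromBlocks X Y Yᴴ W).PosSemidef) :
    normInf p Y ^ 2 ≤ normInf p X * normInf p W := by
  -- The square root puts the bound in the linear form that `normInf_le` accepts. For fixed `C`,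
  -- `D`, the corners become `C X Cᴴ` and `Dᴴ W D`, each costing the square of one Schatten norm.
  have key : normInf p Y ≤ (normInf p X * normInf p W) ^ (1 / 2 : ℝ) := by
    refine normInf_le fun C D => ?_
    have h1 := schattenNorm_sq_le_of_posSemidef hp
      (PosSemidef.fromBlocks_conj h (ampl n C) (ampl n D))
    have h2 := schattenNorm_le_normInf hp X C Cᴴ
    have h3 := schattenNorm_le_normInf hp W Dᴴ D
    rw [schattenNorm_conjTranspose] at h2 h3
    rw [ampl_conjTranspose, ampl_conjTranspose] at h1
    rw [← ENNReal.pow_le_pow_left_iff two_ne_zero]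
    refine (h1.trans (mul_le_mul' h2 h3)).trans (le_of_eq ?_)
    rw [mul_pow, ← ENNReal.rpow_natCast (_ ^ _), ← ENNReal.rpow_mul]
    norm_num
    ring
  calc _ ≤ ((normInf p X * normInf p W) ^ (1 / 2 : ℝ)) ^ 2 := by gcongr
    _ = _ := by
      rw [← ENNReal.rpow_natCast (_ ^ _), ← ENNReal.rpow_mul]
      norm_num

theorem mixedNorm_le (t p : ℝ≥0∞) {Y : Matrix (Fin d × Fin n) (Fin d × Fin n) ℂ}
    {A B : Matrix (Fin d) (Fin d) ℂ} {Z : Matrix (Fin d × Fin n) (Fin d × Fin n) ℂ}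
    (h : Y = ampl n A * Z * ampl n B) :
    mixedNorm t p Y ≤ schattenNorm (2 * t) A * schattenNorm (2 * t) B * normInf p Z :=
  iInf₂_le_of_le A B (iInf₂_le_of_le Z h le_rfl)

theorem mixedNorm_lt_iff {t p : ℝ≥0∞} {Y : Matrix (Fin d × Fin n) (Fin d × Fin n) ℂ} {c : ℝ≥0∞} :
    mixedNorm t p Y < c ↔ ∃ A B Z, Y = ampl n A * Z * ampl n B ∧
      schattenNorm (2 * t) A * schattenNorm (2 * t) B * normInf p Z < c := by
  simp only [mixedNorm, iInf_lt_iff, exists_prop]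

end

/-! ### Complex powers, symmetric factorizations, and Cauchy-Schwarz for mixed norms. -/

section
open Matrix Filter Topology
open scoped Matrix.Norms.L2Operator

theorem exists_coe_eq {x : ℝ≥0∞} (hx : x ≠ ∞) : ∃ y : NNReal, (y : ℝ≥0∞) = x :=
  ⟨x.toNNReal, ENNReal.coe_toNNReal hx⟩

section
variable {ι : Type*} [Fintype ι] [DecidableEq ι]

/-- The complex power `W * diag (s ^ w) * Wᴴ` of the matrix `W * diag s * Wᴴ`. -/
noncomputable def matPow (W : Matrix ι ι ℂ) (s : ι → ℝ) (w : ℂ) : Matrix ι ι ℂ :=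
  W * diagonal (fun i => cpow0 (s i) w) * Wᴴ

theorem matPow_mul {W : Matrix ι ι ℂ} (hW : W ∈ unitaryGroup ι ℂ) (s : ι → ℝ) (z w : ℂ) :
    matPow W s z * matPow W s w = matPow W s (z + w) := by
  have hW1 : Wᴴ * W = 1 := mem_unitaryGroup_iff'.1 hW
  simp only [matPow, cpow0_add, ← diagonal_mul_diagonal]
  simp only [Matrix.mul_assoc]
  rw [← Matrix.mul_assoc Wᴴ W, hW1, Matrix.one_mul]

theorem matPow_zero {W : Matrix ι ι ℂ} (hW : W ∈ unitaryGroup ι ℂ) {s : ι → ℝ}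
    (hs : ∀ i, 0 < s i) : matPow W s 0 = 1 := by
  have hW2 : W * Wᴴ = 1 := mem_unitaryGroup_iff.1 hW
  simp [matPow, cpow0, (hs _).ne', hW2]

theorem matPow_one (W : Matrix ι ι ℂ) {s : ι → ℝ} (hs : ∀ i, 0 ≤ s i) :
    matPow W s 1 = W * diagonal (fun i => (s i : ℂ)) * Wᴴ := by
  rw [matPow]
  congr 3
  funext i
  have := cpow0_ofReal (hs i) one_ne_zero
  simpa using this

theorem matPow_ofReal_conjTranspose (W : Matrix ι ι ℂ) {s : ι → ℝ}
    (hs : ∀ i, 0 < s i) (x : ℝ) : (matPow W s x)ᴴ = matPow W s x := by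
  simp only [matPow, conjTranspose_mul, conjTranspose_conjTranspose, diagonal_conjTranspose,
    Matrix.mul_assoc]
  congr 3
  funext i
  simp only [Pi.star_apply, cpow0, if_neg (hs i).ne', ← Complex.ofReal_cpow (hs i).le]
  simp

theorem norm_matPow_le_one {W : Matrix ι ι ℂ} (hW : W ∈ unitaryGroup ι ℂ) {s : ι → ℝ}
    (hs : ∀ i, 0 ≤ s i) {w : ℂ} (hw : w.re = 0) : ‖matPow W s w‖ ≤ 1 :=
  (norm_unitary_mul_mul_le hW (Unitary.star_mem hW)).trans
    (norm_diagonal_le zero_le_one fun i => norm_cpow0_le_one (hs i) hw)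

theorem MatStripBounded.matPow (W : Matrix ι ι ℂ) {s : ι → ℝ} (hs : ∀ i, 0 ≤ s i) (a b : ℝ) :
    MatStripBounded fun z => matPow W s (a * z + b) :=
  ((MatStripBounded.const W).mul
    (MatStripBounded.diagonal fun i => StripBounded.cpow0 (hs i) a b)).mul (MatStripBounded.const _)

/-- Polar decomposition of an invertible matrix. -/
theorem exists_polar {M : Matrix ι ι ℂ} (hM : IsUnit M) :
    ∃ V ∈ unitaryGroup ι ℂ, ∃ W ∈ unitaryGroup ι ℂ, ∃ s : ι → ℝ, (∀ i, 0 < s i) ∧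
      M = V * matPow W s 1 := by
  obtain ⟨U, hU, V, hV, s, hs, h⟩ := exists_svd' M
  have hs' : ∀ i, 0 < s i := by
    have hd : M.det ≠ 0 := ((isUnit_iff_isUnit_det M).1 hM).ne_zero
    rw [h, det_mul, det_mul, det_diagonal] at hd
    intro i
    refine (hs i).lt_of_ne' fun h0 => hd ?_
    rw [Finset.prod_eq_zero (Finset.mem_univ i) (by simp [h0])]
    simp
  refine ⟨U * V, mul_mem hU hV, star V, Unitary.star_mem hV, s, hs', ?_⟩
  rw [matPow_one _ hs, star_eq_conjTranspose, conjTranspose_conjTranspose, h]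
  have hV2 : V * Vᴴ = 1 := mem_unitaryGroup_iff.1 hV
  simp only [Matrix.mul_assoc]
  rw [← Matrix.mul_assoc V Vᴴ, hV2, Matrix.one_mul]

/-- Every matrix is an invertible matrix of nearly the same norm times a contraction. -/
theorem exists_isUnit_mul_contraction {p : ℝ≥0∞} (hp : 1 ≤ p) (A : Matrix ι ι ℂ) {ε : NNReal}
    (hε : 0 < ε) : ∃ A' K : Matrix ι ι ℂ, IsUnit A' ∧ A = A' * K ∧ ‖K‖ ≤ 1 ∧
      schattenNorm p A' ≤ schattenNorm p A + ε * schattenNorm p (1 : Matrix ι ι ℂ) := by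
  obtain ⟨U, hU, V, hV, s, hs, h⟩ := exists_svd' A
  have hV2 : V * Vᴴ = 1 := mem_unitaryGroup_iff.1 hV
  have hε' : (0 : ℝ) < ε := hε
  have hse : ∀ i, ((s i + ε : ℝ) : ℂ) ≠ 0 := fun i => by
    exact_mod_cast (add_pos_of_nonneg_of_pos (hs i) hε').ne'
  set D : Matrix ι ι ℂ := diagonal fun i => ((s i + ε : ℝ) : ℂ) with hD
  refine ⟨U * D * V, star V * diagonal (fun i => ((s i / (s i + ε) : ℝ) : ℂ)) * V, ?_, ?_, ?_, ?_⟩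
  · rw [isUnit_iff_isUnit_det, det_mul, det_mul, isUnit_iff_ne_zero, hD, det_diagonal]
    have h1 : ∀ U ∈ unitaryGroup ι ℂ, U.det ≠ 0 := fun U hU h0 => by
      have := congrArg det (mem_unitaryGroup_iff.1 hU)
      rw [det_mul, h0] at this
      simp at this
    exact mul_ne_zero (mul_ne_zero (h1 U hU) (Finset.prod_ne_zero_iff.2 fun i _ => hse i)) (h1 V hV)
  · have hDD : D * diagonal (fun i => ((s i / (s i + ε) : ℝ) : ℂ))
        = diagonal (fun i => (s i : ℂ)) := by
      rw [hD, diagonal_mul_diagonal]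
      congr 1; funext i
      have := hse i
      push_cast at this ⊢
      field_simp
    rw [h, star_eq_conjTranspose, ← hDD]
    simp only [Matrix.mul_assoc]
    rw [← Matrix.mul_assoc V Vᴴ, hV2, Matrix.one_mul]
  · refine (norm_unitary_mul_mul_le (Unitary.star_mem hV) hV).trans
      (norm_diagonal_le zero_le_one fun i => ?_)
    have := hs i
    rw [Complex.norm_real, Real.norm_of_nonneg (by positivity)]
    exact div_le_one_of_le₀ (by linarith) (by positivity)
  · have : U * D * V = A + (ε : ℂ) • (U * 1 * V) := by
      have hD' : D = diagonal (fun i => (s i : ℂ)) + (ε : ℂ) • 1 := by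
        rw [hD, smul_one_eq_diagonal, diagonal_add]
        congr 1; funext i; push_cast; rfl
      rw [hD', h, Matrix.mul_add, Matrix.add_mul]
      simp
    rw [this]
    refine (schattenNorm_add_le hp _ _).trans (le_of_eq ?_)
    rw [schattenNorm_smul hp, schattenNorm_unitary_mul p hU hV]
    congr 2
    rw [← ofReal_norm]
    simp
end

variable {d n : ℕ}

/-- Conjugating a Hermitian matrix by a positive matrix and its inverse increases `normInf`. -/
theorem normInf_le_of_hermitian_conj {p : ℝ≥0∞} (hp : 1 ≤ p) {W : Matrix (Fin d) (Fin d) ℂ}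
    (hW : W ∈ unitaryGroup (Fin d) ℂ) {s : Fin d → ℝ} (hs : ∀ i, 0 < s i)
    {H Z : Matrix (Fin d × Fin n) (Fin d × Fin n) ℂ} (hH : H.IsHermitian)
    (hZ : Z = ampl n (matPow W s (1 / 2 : ℝ)) * H * ampl n (matPow W s (-(1 / 2) : ℝ))) :
    normInf p H ≤ normInf p Z := by
  have hp2 := one_le_two_mul hp
  have hs0 := fun i => (hs i).le
  have hZ' : Zᴴ = ampl n (matPow W s (-(1 / 2) : ℝ)) * H * ampl n (matPow W s (1 / 2 : ℝ)) := by
    rw [hZ]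
    simp only [conjTranspose_mul, ampl_conjTranspose, matPow_ofReal_conjTranspose W hs, hH.eq,
      Matrix.mul_assoc]
  refine normInf_le fun C D => ?_
  obtain ⟨q, hq⟩ := exists_holderConjugate hp
  obtain ⟨G, hG, h⟩ := exists_schattenNorm_dual p q (ampl n C * H * ampl n D)
  let T : ℂ → Matrix (Fin d × Fin n) (Fin d × Fin n) ℂ := fun w => ampl n (matPow W s w)
  have hT : ∀ z w, T z * T w = T (z + w) := fun z w => by
    simp only [T, ← ampl_mul, matPow_mul hW]
  have hT0 : T 0 = 1 := by simp only [T, matPow_zero hW hs, ampl_one]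
  -- `F` conjugates `H` by the complex power `1/2 - z`. At `z = 1/2` the conjugation is trivial; on
  -- the edge `re z = 0` it yields `Z`, and on `re z = 1` it yields `Zᴴ`, because `H` is Hermitian.
  -- The remaining imaginary powers are contractions absorbed into `C` and `D`.
  let F : ℂ → Matrix (Fin d × Fin n) (Fin d × Fin n) ℂ := fun z =>
    ampl n C * T ((-1 : ℝ) * z + (1 / 2 : ℝ)) * H * T ((1 : ℝ) * z + (-(1 / 2) : ℝ)) * ampl n D
  have hTb : ∀ a b : ℝ, MatStripBounded fun z => T (a * z + b) := by
    intro a b x y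
    simp only [T, ampl]
    exact (MatStripBounded.matPow W hs0 a b _ _).mul (StripBounded.const _)
  have hF : StripBounded fun z => (F z * G).trace :=
    MatStripBounded.trace (((((MatStripBounded.const _).mul (hTb _ _)).mul
      (MatStripBounded.const _)).mul (hTb _ _)).mul (MatStripBounded.const _) |>.mul
      (MatStripBounded.const _))
  have hedge : ∀ (Y : Matrix (Fin d × Fin n) (Fin d × Fin n) ℂ), normInf p Y ≤ normInf p Z →
      ∀ w : ℂ, w.re = 0 →
      ‖(ampl n C * T (-w) * Y * T w * ampl n D * G).trace‖ₑ ≤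
        schattenNorm (2 * p) C * schattenNorm (2 * p) D * normInf p Z := by
    intro Y hY w hw
    refine (enorm_trace_mul_le p q _ G).trans ((mul_le_of_le_one_right' hG).trans ?_)
    have h1 := schattenNorm_le_normInf hp Y (C * matPow W s (-w)) (matPow W s w * D)
    have h2 := schattenNorm_contraction_le hp2 norm_one_matrix_le
      (norm_matPow_le_one hW hs0 (w := -w) (by simpa using hw)) C
    have h3 := schattenNorm_contraction_le hp2 (norm_matPow_le_one hW hs0 hw)
      norm_one_matrix_le D
    rw [Matrix.one_mul] at h2
    rw [Matrix.mul_one] at h3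
    simp only [ampl_mul, Matrix.mul_assoc] at h1
    simp only [T, Matrix.mul_assoc]
    exact h1.trans (by gcongr)
  have h0 : F (1 / 2 : ℝ) = ampl n C * H * ampl n D := by
    simp only [F]
    rw [show ((-1 : ℝ) : ℂ) * (1 / 2 : ℝ) + (1 / 2 : ℝ) = 0 by push_cast; ring,
      show ((1 : ℝ) : ℂ) * (1 / 2 : ℝ) + (-(1 / 2) : ℝ) = 0 by push_cast; ring, hT0,
      Matrix.mul_one, Matrix.mul_one]
  rw [← h, ← h0]
  refine hF.enorm_le (z := (1 / 2 : ℝ)) (fun z hz => ?_) (fun z hz => ?_) ?_ ?_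
  · have : F z = ampl n C * T (-z) * Z * T z * ampl n D := by
      rw [hZ]
      simp only [F]
      rw [show ((-1 : ℝ) : ℂ) * z + (1 / 2 : ℝ) = -z + (1 / 2 : ℝ) by push_cast; ring,
        show ((1 : ℝ) : ℂ) * z + (-(1 / 2) : ℝ) = (-(1 / 2) : ℝ) + z by push_cast; ring,
        ← hT, ← hT]
      simp only [T, Matrix.mul_assoc]
    rw [this]
    exact hedge Z le_rfl z hz
  · have : F z = ampl n C * T (-(z - 1)) * Zᴴ * T (z - 1) * ampl n D := by
      rw [hZ']
      simp only [F]
      rw [show ((-1 : ℝ) : ℂ) * z + (1 / 2 : ℝ) = -(z - 1) + (-(1 / 2) : ℝ) by push_cast; ring,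
        show ((1 : ℝ) : ℂ) * z + (-(1 / 2) : ℝ) = (1 / 2 : ℝ) + (z - 1) by push_cast; ring,
        ← hT, ← hT]
      simp only [T, Matrix.mul_assoc]
    rw [this]
    exact hedge Zᴴ (normInf_conjTranspose_le hp Z) (z - 1) (by simp [hz])
  · simp
  · simp; norm_num

theorem ampl_inv_mul {a : Matrix (Fin d) (Fin d) ℂ} (ha : IsUnit a) :
    ampl n a⁻¹ * ampl n a = 1 := by
  rw [← ampl_mul, nonsing_inv_mul _ ((isUnit_iff_isUnit_det a).1 ha), ampl_one]

theorem ampl_mul_inv {a : Matrix (Fin d) (Fin d) ℂ} (ha : IsUnit a) :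
    ampl n a * ampl n a⁻¹ = 1 := by
  rw [← ampl_mul, mul_nonsing_inv _ ((isUnit_iff_isUnit_det a).1 ha), ampl_one]

/-- A factorization of a Hermitian matrix can be replaced by a symmetric one. -/
theorem exists_symmetric_factorization {t p : ℝ≥0∞} (ht : 1 ≤ t) (hp : 1 ≤ p)
    {X Z : Matrix (Fin d × Fin n) (Fin d × Fin n) ℂ} (hX : X.IsHermitian)
    {A B : Matrix (Fin d) (Fin d) ℂ} (hA : IsUnit A) (hB : IsUnit B)
    (h : X = ampl n A * Z * ampl n B) :
    ∃ a H, IsUnit a ∧ X = ampl n a * H * (ampl n a)ᴴ ∧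
      schattenNorm (2 * t) a ^ 2 ≤ schattenNorm (2 * t) A * schattenNorm (2 * t) B ∧
      normInf p H ≤ normInf p Z := by
  have ht0 : t ≠ 0 := (zero_lt_one.trans_le ht).ne'
  have hA' : IsUnit Aᴴ := hA.star
  have hdet := (isUnit_iff_isUnit_det _).1 hA'
  have hM : IsUnit (B * (Aᴴ)⁻¹) := hB.mul (isUnit_nonsing_inv_iff.2 hA')
  -- The polar decomposition of `B (Aᴴ)⁻¹` measures how far the factorization is from symmetric: `B
  -- = V P² Aᴴ`. Giving one factor `P` to each side turns the outer factors into `A P` and its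
  -- adjoint.
  obtain ⟨V, hV, W, hW, s, hs, hVP⟩ := exists_polar hM
  have hV1 : Vᴴ * V = 1 := mem_unitaryGroup_iff'.1 hV
  have hBV : B = V * matPow W s 1 * Aᴴ := by
    rw [← hVP, Matrix.mul_assoc, nonsing_inv_mul _ hdet, Matrix.mul_one]
  set P := matPow W s (1 / 2 : ℝ) with hP
  set N := matPow W s (-(1 / 2) : ℝ) with hN
  have hPN : P * N = 1 := by
    rw [hP, hN, matPow_mul hW, ← matPow_zero hW hs]; congr 1; push_cast; ring
  have hNP : N * P = 1 := by
    rw [hP, hN, matPow_mul hW, ← matPow_zero hW hs]; congr 1; push_cast; ring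
  have hPP : P * P = matPow W s 1 := by
    rw [hP, matPow_mul hW]; congr 1; push_cast; ring
  have hPH : Pᴴ = P := matPow_ofReal_conjTranspose W hs _
  have hPu : IsUnit P := IsUnit.of_mul_eq_one _ hPN
  have ha : IsUnit (A * P) := hA.mul hPu
  set H := ampl n N * (Z * ampl n V) * ampl n P with hH
  have hXH : X = ampl n (A * P) * H * (ampl n (A * P))ᴴ := by
    rw [h, hBV, ← hPP, hH, ampl_conjTranspose, conjTranspose_mul, hPH]
    have e : ampl n P * ampl n N = 1 := by rw [← ampl_mul, hPN, ampl_one]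
    simp only [ampl_mul, Matrix.mul_assoc]
    rw [← Matrix.mul_assoc (ampl n P) (ampl n N), e, Matrix.one_mul]
  have hHH : H.IsHermitian := by
    have e := ampl_inv_mul (n := n) ha
    have : H = ampl n (A * P)⁻¹ * X * (ampl n (A * P)⁻¹)ᴴ := by
      rw [hXH]
      have e2 := congrArg conjTranspose e
      rw [conjTranspose_mul, conjTranspose_one] at e2
      simp only [Matrix.mul_assoc]
      rw [e2, Matrix.mul_one, ← Matrix.mul_assoc, e, Matrix.one_mul]
    rw [this]
    exact isHermitian_mul_mul_conjTranspose _ hX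
  refine ⟨A * P, H, ha, hXH, ?_, ?_⟩
  · rw [← schattenNorm_mul_conjTranspose_self ht0]
    -- `P² Aᴴ = Vᴴ B`, so Hölder's inequality bounds the squared norm of `A P` by the product of the
    -- norms of `A` and `B`.
    have : A * P * (A * P)ᴴ = A * (Vᴴ * B * 1) := by
      rw [hBV, ← hPP, conjTranspose_mul, hPH]
      simp only [Matrix.mul_assoc, Matrix.mul_one]
      rw [← Matrix.mul_assoc Vᴴ V, hV1, Matrix.one_mul]
    rw [this]
    refine (schattenNorm_mul_le ht _ _).trans (le_of_eq ?_)
    rw [← star_eq_conjTranspose, schattenNorm_unitary_mul _ (Unitary.star_mem hV) (one_mem _) B]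
  · have h1 : normInf p H ≤ normInf p (Z * ampl n V) := by
      refine normInf_le_of_hermitian_conj hp hW hs hHH ?_
      rw [hH, ← hP, ← hN]
      have e : ampl n P * ampl n N = 1 := by rw [← ampl_mul, hPN, ampl_one]
      simp only [Matrix.mul_assoc]
      rw [e, Matrix.mul_one, ← Matrix.mul_assoc, e, Matrix.one_mul]
    refine h1.trans ?_
    have := normInf_contraction_le hp norm_one_matrix_le (norm_unitary_le hV) Z
    rwa [ampl_one, Matrix.one_mul] at this

/-- Removes the invertibility assumption: the outer factors are replaced by invertible ones of
slightly larger norm and the leftover contractions go into the middle. The strict inequality leaves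
room for this perturbation. -/
theorem exists_symmetric_factorization_of_lt {t p : ℝ≥0∞} (ht : 1 ≤ t) (hp : 1 ≤ p)
    {X : Matrix (Fin d × Fin n) (Fin d × Fin n) ℂ} (hX : X.IsHermitian) {c : ℝ≥0∞}
    (hc : mixedNorm t p X < c) :
    ∃ a H, IsUnit a ∧ X = ampl n a * H * (ampl n a)ᴴ ∧
      schattenNorm (2 * t) a ^ 2 * normInf p H < c := by
  have ht2 := one_le_two_mul ht
  obtain ⟨A, B, Z, hXZ, hlt⟩ := mixedNorm_lt_iff.1 hc
  obtain ⟨α, hα⟩ := exists_coe_eq (schattenNorm_ne_top ht2 A)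
  obtain ⟨β, hβ⟩ := exists_coe_eq (schattenNorm_ne_top ht2 B)
  obtain ⟨κ, hκ⟩ := exists_coe_eq (schattenNorm_ne_top ht2 (1 : Matrix (Fin d) (Fin d) ℂ))
  obtain ⟨ν, hν⟩ := exists_coe_eq (normInf_ne_top hp Z)
  rw [← hα, ← hβ, ← hν] at hlt
  have hcont : Continuous fun ε : NNReal =>
      (((α + ε * κ) * (β + ε * κ) * ν : NNReal) : ℝ≥0∞) :=
    ENNReal.continuous_coe.comp (by fun_prop)
  have hev : ∀ᶠ ε : NNReal in 𝓝[>] 0, (((α + ε * κ) * (β + ε * κ) * ν : NNReal) : ℝ≥0∞) < c := by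
    refine (hcont.tendsto 0).mono_left nhdsWithin_le_nhds |>.eventually_lt_const ?_
    simpa using hlt
  obtain ⟨ε, hε, hεpos⟩ := (hev.and self_mem_nhdsWithin).exists
  obtain ⟨A', K, hA', hAK, hK, hAn⟩ := exists_isUnit_mul_contraction ht2 A hεpos
  -- Applied to `Bᴴ`, so that after taking adjoints the contraction stands to the left of the
  -- invertible factor, next to `Z`.
  obtain ⟨B', L, hB', hBL, hL, hBn⟩ := exists_isUnit_mul_contraction ht2 Bᴴ hεpos
  have hX' : X = ampl n A' * (ampl n K * Z * ampl n Lᴴ) * ampl n B'ᴴ := by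
    have : B = Lᴴ * B'ᴴ := by rw [← conjTranspose_mul, ← hBL, conjTranspose_conjTranspose]
    rw [hXZ, hAK, this]
    simp only [ampl_mul, Matrix.mul_assoc]
  obtain ⟨a, H, ha, hXH, han, hHn⟩ := exists_symmetric_factorization ht hp hX hA' hB'.star hX'
  refine ⟨a, H, ha, hXH, lt_of_le_of_lt ?_ hε⟩
  rw [schattenNorm_conjTranspose] at hBn
  change schattenNorm (2 * t) a ^ 2 ≤ schattenNorm (2 * t) A' * schattenNorm (2 * t) B'ᴴ at han
  rw [schattenNorm_conjTranspose] at han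
  push_cast
  rw [hα, hβ, hν, hκ]
  refine (mul_le_mul' han (hHn.trans (normInf_contraction_le hp hK ?_ Z))).trans ?_
  · rwa [l2_opNorm_conjTranspose]
  · gcongr

theorem mixedNorm_ne_top {t p : ℝ≥0∞} (ht : 1 ≤ t) (hp : 1 ≤ p)
    (Y : Matrix (Fin d × Fin n) (Fin d × Fin n) ℂ) : mixedNorm t p Y ≠ ∞ := by
  have ht2 := one_le_two_mul ht
  refine ne_top_of_le_ne_top ?_ (mixedNorm_le t p (A := 1) (B := 1) (Z := Y) (by simp [ampl_one]))
  exact ENNReal.mul_ne_top (ENNReal.mul_ne_top (schattenNorm_ne_top ht2 _)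
    (schattenNorm_ne_top ht2 _)) (normInf_ne_top hp Y)

/-- The Cauchy-Schwarz inequality for the mixed norms of the blocks of a positive semidefinite
block matrix. -/
theorem mixedNorm_sq_le_of_posSemidef {t p : ℝ≥0∞} (ht : 1 ≤ t) (hp : 1 ≤ p)
    {X Y W : Matrix (Fin d × Fin n) (Fin d × Fin n) ℂ}
    (h : (fromBlocks X Y Yᴴ W).PosSemidef) :
    mixedNorm t p Y ^ 2 ≤ mixedNorm t p X * mixedNorm t p W := by
  obtain ⟨hX, -, -, hW⟩ := isHermitian_fromBlocks_iff.1 h.isHermitian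
  -- Working with every `x`, `w` strictly above the two norms avoids having to attain the infima.
  refine ENNReal.le_mul_of_forall_lt (Or.inr (mixedNorm_ne_top ht hp W))
    (Or.inl (mixedNorm_ne_top ht hp X)) fun x hx w hw => ?_
  obtain ⟨a, H, ha, hXH, hax⟩ := exists_symmetric_factorization_of_lt ht hp hX hx
  obtain ⟨b, H', hb, hWH, hbw⟩ := exists_symmetric_factorization_of_lt ht hp hW hw
  -- Dividing out `a` and `b` keeps the block matrix positive and leaves `H`, `H'` on the diagonal,
  -- where the `(∞,p)` inequality applies.
  have hb' := PosSemidef.fromBlocks_conj h (ampl n a⁻¹) (ampl n b⁻¹)ᴴ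
  have ea := ampl_inv_mul (n := n) ha
  have eb := ampl_inv_mul (n := n) hb
  have ea' := ampl_mul_inv (n := n) ha
  have eb' := congrArg conjTranspose (ampl_mul_inv (n := n) hb)
  have ea2 := congrArg conjTranspose ea
  have eb2 := congrArg conjTranspose eb
  rw [conjTranspose_mul, conjTranspose_one] at ea2 eb2 eb'
  have h1 : ampl n a⁻¹ * X * (ampl n a⁻¹)ᴴ = H := by
    rw [hXH]
    simp only [Matrix.mul_assoc]
    rw [ea2, Matrix.mul_one, ← Matrix.mul_assoc, ea, Matrix.one_mul]
  have h2 : (ampl n b⁻¹)ᴴᴴ * W * (ampl n b⁻¹)ᴴ = H' := by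
    rw [hWH, conjTranspose_conjTranspose]
    simp only [Matrix.mul_assoc]
    rw [eb2, Matrix.mul_one, ← Matrix.mul_assoc, eb, Matrix.one_mul]
  rw [h1, h2] at hb'
  set Y' := ampl n a⁻¹ * Y * (ampl n b⁻¹)ᴴ with hY'
  have hY : Y = ampl n a * Y' * ampl n bᴴ := by
    rw [hY', ← ampl_conjTranspose b]
    simp only [Matrix.mul_assoc]
    rw [eb', Matrix.mul_one, ← Matrix.mul_assoc, ea', Matrix.one_mul]
  have h3 := mixedNorm_le t p hY
  rw [schattenNorm_conjTranspose] at h3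
  calc mixedNorm t p Y ^ 2
      ≤ (schattenNorm (2 * t) a * schattenNorm (2 * t) b * normInf p Y') ^ 2 := by gcongr
    _ = schattenNorm (2 * t) a ^ 2 * schattenNorm (2 * t) b ^ 2 * normInf p Y' ^ 2 := by ring
    _ ≤ schattenNorm (2 * t) a ^ 2 * schattenNorm (2 * t) b ^ 2 *
        (normInf p H * normInf p H') := by gcongr; exact normInf_sq_le_of_posSemidef hp hb'
    _ = (schattenNorm (2 * t) a ^ 2 * normInf p H) *
        (schattenNorm (2 * t) b ^ 2 * normInf p H') := by ring
    _ ≤ x * w := mul_le_mul' hax.le hbw.le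

end

/-! ### Partial traces and interpolation between contractions and Hilbert-Schmidt matrices. -/

section
open Matrix Filter Topology
open scoped Matrix.Norms.L2Operator

section
variable {ι : Type*} [Fintype ι] [DecidableEq ι]

theorem exists_eq_matPow {Q : Matrix ι ι ℂ} (hQ : Q.PosDef) :
    ∃ W ∈ unitaryGroup ι ℂ, ∃ s : ι → ℝ, (∀ i, 0 < s i) ∧ Q = matPow W s 1 := by
  refine ⟨hQ.isHermitian.eigenvectorUnitary, hQ.isHermitian.eigenvectorUnitary.2,
    hQ.isHermitian.eigenvalues, hQ.eigenvalues_pos, ?_⟩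
  rw [matPow_one _ fun i => (hQ.eigenvalues_pos i).le]
  exact hQ.isHermitian.spectral_theorem

/-- The matrix `U * diag (s ^ w) * V`. -/
noncomputable def svdPow (U : Matrix ι ι ℂ) (s : ι → ℝ) (V : Matrix ι ι ℂ) (w : ℂ) :
    Matrix ι ι ℂ :=
  U * diagonal (fun i => cpow0 (s i) w) * V

theorem svdPow_one (U V : Matrix ι ι ℂ) {s : ι → ℝ} (hs : ∀ i, 0 ≤ s i) :
    svdPow U s V 1 = U * diagonal (fun i => (s i : ℂ)) * V := by
  rw [svdPow]
  congr 3
  funext i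
  have := cpow0_ofReal (hs i) one_ne_zero
  simpa using this

theorem MatStripBounded.svdPow (U V : Matrix ι ι ℂ) {s : ι → ℝ} (hs : ∀ i, 0 ≤ s i) (a b : ℝ) :
    MatStripBounded fun z => svdPow U s V (a * z + b) :=
  ((MatStripBounded.const U).mul
    (MatStripBounded.diagonal fun i => StripBounded.cpow0 (hs i) a b)).mul (MatStripBounded.const V)

theorem norm_svdPow_le_one {U V : Matrix ι ι ℂ} (hU : U ∈ unitaryGroup ι ℂ)
    (hV : V ∈ unitaryGroup ι ℂ) {s : ι → ℝ} (hs : ∀ i, 0 ≤ s i) {w : ℂ} (hw : w.re = 0) :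
    ‖svdPow U s V w‖ ≤ 1 :=
  (norm_unitary_mul_mul_le hU hV).trans
    (norm_diagonal_le zero_le_one fun i => norm_cpow0_le_one (hs i) hw)

/-- The imaginary part of the exponent contributes only a contraction. A nonzero real part is
required for the splitting because `cpow0 0 0 = 0` whereas the real power `0 ^ 0` is `1`. -/
theorem schattenNorm_svdPow_le {p : ℝ≥0∞} (hp : 1 ≤ p) {U V : Matrix ι ι ℂ}
    (hU : U ∈ unitaryGroup ι ℂ) (hV : V ∈ unitaryGroup ι ℂ) {s : ι → ℝ} (hs : ∀ i, 0 ≤ s i)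
    {w : ℂ} (hw : w.re ≠ 0) :
    schattenNorm p (svdPow U s V w) ≤ lpSum p fun i => s i ^ w.re := by
  have h1 : svdPow U s V w = svdPow U s 1 (w.im * Complex.I) *
      (1 * diagonal (fun i => ((s i ^ w.re : ℝ) : ℂ)) * 1) * V := by
    have : w = w.im * Complex.I + w.re := by rw [add_comm, Complex.re_add_im]
    conv_lhs => rw [this]
    simp only [svdPow, cpow0_add, cpow0_ofReal (hs _) hw, ← diagonal_mul_diagonal, Matrix.mul_one,
      Matrix.one_mul, Matrix.mul_assoc]
  rw [h1]
  refine (schattenNorm_contraction_le hp (norm_svdPow_le_one hU (one_mem _) hs (by simp))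
    (norm_unitary_le hV) _).trans (le_of_eq ?_)
  exact schattenNorm_eq_lpSum p (one_mem _) (one_mem _) (fun i => Real.rpow_nonneg (hs i) _) rfl

end

theorem lpSum_rpow {κ : Type*} [Fintype κ] {p r : ℝ≥0∞} {a : ℝ} (ha : 0 < a) (hp : p ≠ ∞)
    (hr : r ≠ ∞) (h : p.toReal * a = r.toReal) {t : κ → ℝ} (ht : ∀ i, 0 ≤ t i) :
    lpSum p (fun i => t i ^ a) = lpSum r t ^ a := by
  rw [lpSum, lpSum, if_neg hp, if_neg hr, ← ENNReal.rpow_mul]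
  have h1 : ∑ i, ENNReal.ofReal (t i ^ a) ^ p.toReal = ∑ i, ENNReal.ofReal (t i) ^ r.toReal := by
    refine Finset.sum_congr rfl fun i _ => ?_
    rw [← ENNReal.ofReal_rpow_of_nonneg (ht i) ha.le, ← ENNReal.rpow_mul, mul_comm, h]
  rw [h1, ← h]
  congr 1
  field_simp

theorem lpSum_rpow_le_one {κ : Type*} [Fintype κ] {p r : ℝ≥0∞} {a : ℝ} (ha : 0 < a) (hp : p ≠ ∞)
    (hr : r ≠ ∞) (h : p.toReal * a = r.toReal) {t : κ → ℝ} (ht : ∀ i, 0 ≤ t i)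
    (h1 : lpSum r t ≤ 1) : lpSum p (fun i => t i ^ a) ≤ 1 := by
  rw [lpSum_rpow ha hp hr h ht]
  exact ENNReal.rpow_le_one h1 ha.le

variable {d n : ℕ}

/-- The partial trace over the second factor. -/
noncomputable def partialTrace (N : Matrix (Fin d × Fin n) (Fin d × Fin n) ℂ) :
    Matrix (Fin d) (Fin d) ℂ :=
  ∑ k : Fin n, N.submatrix (fun i => (i, k)) fun i => (i, k)

theorem trace_ampl_mul (M : Matrix (Fin d) (Fin d) ℂ)
    (N : Matrix (Fin d × Fin n) (Fin d × Fin n) ℂ) :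
    (ampl n M * N).trace = (M * partialTrace N).trace := by
  simp only [trace, diag_apply, mul_apply, partialTrace, Fintype.sum_prod_type, ampl,
    kronecker_apply, one_apply, Matrix.sum_apply, submatrix_apply, Finset.mul_sum]
  simp only [mul_ite, mul_one, mul_zero, ite_mul, zero_mul, Finset.sum_ite_eq, Finset.mem_univ,
    if_true]

theorem partialTrace_posDef (hn : 0 < n) {N : Matrix (Fin d × Fin n) (Fin d × Fin n) ℂ}
    (hN : N.PosDef) : (partialTrace N).PosDef := by
  have : Nonempty (Fin n) := ⟨⟨0, hn⟩⟩
  refine posDef_sum Finset.univ_nonempty fun k _ => hN.submatrix ?_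
  intro i j h
  exact (Prod.mk.inj h).1

theorem trace_partialTrace (N : Matrix (Fin d × Fin n) (Fin d × Fin n) ℂ) :
    (partialTrace N).trace = N.trace := by
  have := trace_ampl_mul 1 N
  rw [ampl_one, Matrix.one_mul, Matrix.one_mul] at this
  exact this.symm

theorem MatStripBounded.ampl {F : ℂ → Matrix (Fin d) (Fin d) ℂ} (hF : MatStripBounded F) :
    MatStripBounded fun z => ampl n (F z) := fun x y => by
  simp only [CBNorm.ampl]
  exact (hF _ _).mul (StripBounded.const _)

section
variable {ι : Type*} [Fintype ι] [DecidableEq ι]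

theorem schattenNorm_two' (A : Matrix ι ι ℂ) :
    schattenNorm 2 A = ENNReal.ofReal (A * Aᴴ).trace.re ^ (1 / 2 : ℝ) := by
  rw [← schattenNorm_conjTranspose, schattenNorm_two, conjTranspose_conjTranspose]

theorem matPow_mul_conjTranspose {W : Matrix ι ι ℂ} (hW : W ∈ unitaryGroup ι ℂ) {s : ι → ℝ}
    (hs : ∀ i, 0 < s i) (w : ℂ) :
    matPow W s w * (matPow W s w)ᴴ = matPow W s ((2 * w.re : ℝ) : ℂ) := by
  have hW1 : Wᴴ * W = 1 := mem_unitaryGroup_iff'.1 hW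
  simp only [matPow, conjTranspose_mul, conjTranspose_conjTranspose, diagonal_conjTranspose,
    Matrix.mul_assoc]
  rw [← Matrix.mul_assoc Wᴴ W, hW1, Matrix.one_mul]
  congr 1
  rw [← Matrix.mul_assoc, diagonal_mul_diagonal]
  congr 2
  funext i
  simp only [Pi.star_apply]
  rw [RCLike.star_def, Complex.mul_conj, Complex.normSq_eq_norm_sq, norm_cpow0 (hs i), cpow0,
    if_neg (hs i).ne', ← Complex.ofReal_cpow (hs i).le, mul_comm, Real.rpow_mul (hs i).le]
  norm_num

theorem matPow_posDef {W : Matrix ι ι ℂ} (hW : W ∈ unitaryGroup ι ℂ) {s : ι → ℝ}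
    (hs : ∀ i, 0 < s i) (x : ℝ) : (matPow W s x).PosDef := by
  have hu : IsUnit W := IsUnit.of_mul_eq_one _ (mem_unitaryGroup_iff.1 hW)
  rw [matPow]
  refine (Matrix.IsUnit.posDef_star_right_conjugate_iff hu).2 (PosDef.diagonal fun i => ?_)
  rw [cpow0, if_neg (hs i).ne', ← Complex.ofReal_cpow (hs i).le]
  exact_mod_cast Real.rpow_pos_of_pos (hs i) x

theorem trace_matPow {W : Matrix ι ι ℂ} (hW : W ∈ unitaryGroup ι ℂ) {s : ι → ℝ}
    (hs : ∀ i, 0 < s i) (x : ℝ) : (matPow W s x).trace = ((∑ i, s i ^ x : ℝ) : ℂ) := by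
  have hW1 : Wᴴ * W = 1 := mem_unitaryGroup_iff'.1 hW
  rw [matPow, trace_mul_comm, ← Matrix.mul_assoc, hW1, Matrix.one_mul, trace_diagonal]
  push_cast
  refine Finset.sum_congr rfl fun i _ => ?_
  rw [cpow0, if_neg (hs i).ne', Complex.ofReal_cpow (hs i).le]

theorem schattenNorm_matPow {W : Matrix ι ι ℂ} (hW : W ∈ unitaryGroup ι ℂ) {s : ι → ℝ}
    (hs : ∀ i, 0 < s i) (p : ℝ≥0∞) (x : ℝ) :
    schattenNorm p (matPow W s x) = lpSum p fun i => s i ^ x := by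
  refine schattenNorm_eq_lpSum p hW (Unitary.star_mem hW)
    (fun i => Real.rpow_nonneg (hs i).le _) ?_
  rw [matPow]
  congr 3
  funext i
  rw [cpow0, if_neg (hs i).ne', Complex.ofReal_cpow (hs i).le]

end

/-- The interpolation estimate behind the identification of `L_q(M_d; L_q(M_n))`. -/
theorem schattenNorm_ampl_mul_le_one {q : ℝ≥0∞} (hq : 1 ≤ q) (hq' : q ≠ ∞)
    {R : Matrix (Fin d × Fin n) (Fin d × Fin n) ℂ} (hR : R ∈ unitaryGroup (Fin d × Fin n) ℂ)
    {l : Fin d × Fin n → ℝ} (hl : ∀ i, 0 < l i)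
    {W : Matrix (Fin d) (Fin d) ℂ} (hW : W ∈ unitaryGroup (Fin d) ℂ)
    {μ : Fin d → ℝ} (hμ : ∀ i, 0 < μ i)
    (hσ : partialTrace (matPow R l q.toReal) = matPow W μ 1)
    {C : Matrix (Fin d) (Fin d) ℂ} (hC : schattenNorm (2 * q) C ≤ 1) :
    schattenNorm (2 * q) (ampl n C * (ampl n (matPow W μ (-(1 / (2 * q.toReal)) : ℝ)) *
      matPow R l (1 / 2 : ℝ))) ≤ 1 := by
  have hq2 := one_le_two_mul hq
  have hq2' : 2 * q ≠ ∞ := ENNReal.mul_ne_top ENNReal.ofNat_ne_top hq'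
  set x := q.toReal with hx
  have hx1 : 1 ≤ x := by
    have := (ENNReal.toReal_le_toReal ENNReal.one_ne_top hq').2 hq
    simpa using this
  have hx0 : 0 < x := by linarith
  have hx2 : (2 * q).toReal = 2 * x := by simp [hx]
  obtain ⟨r, hr⟩ := exists_holderConjugate hq2
  have hr1 : 1 < (2 * q).toReal := by rw [hx2]; linarith
  have hpq := ENNReal.HolderConjugate.toReal hr1 (q := r)
  have hrtop : r ≠ ∞ := fun h => by
    have := hpq.symm.pos
    simp [h] at this
  rw [hx2] at hpq
  set ρ := r.toReal with hρ
  have hρ0 : 0 < ρ := hpq.symm.pos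
  have hinv : ρ * (1 - 1 / (2 * x)) = 1 := by
    have := hpq.inv_add_inv_eq_one
    field_simp at this ⊢
    linarith
  obtain ⟨U, hU, V, hV, s, hs, hCs⟩ := exists_svd' C
  rw [schattenNorm_eq_lpSum (2 * q) hU hV hs hCs] at hC
  obtain ⟨G, hG, h⟩ := exists_schattenNorm_dual (2 * q) r
    (ampl n C * (ampl n (matPow W μ (-(1 / (2 * x)) : ℝ)) * matPow R l (1 / 2 : ℝ)))
  obtain ⟨U', hU', V', hV', t, ht, hGs⟩ := exists_svd' G
  rw [schattenNorm_eq_lpSum r hU' hV' ht hGs] at hG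
  have hl0 := fun i => (hl i).le
  have hμ0 := fun i => (hμ i).le
  -- With `θ = 1/x`, `1/(2x) = (1-θ)/∞ + θ/2`, so the `2q`-norm is interpolated between the operator
  -- norm and the Hilbert-Schmidt norm. The exponents return the original matrices at `z = 1/x`. The
  -- dual factor `Γ` runs from trace class, with exponent `ρ`, to Hilbert-Schmidt, with exponent
  -- `ρ/2`.
  let E : ℂ → Matrix (Fin d) (Fin d) ℂ := fun z => svdPow U s V ((x : ℝ) * z + (0 : ℝ))
  let S : ℂ → Matrix (Fin d) (Fin d) ℂ := fun z => matPow W μ ((-(1 / 2) : ℝ) * z + (0 : ℝ))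
  let L : ℂ → Matrix (Fin d × Fin n) (Fin d × Fin n) ℂ :=
    fun z => matPow R l ((x / 2 : ℝ) * z + (0 : ℝ))
  let Γ : ℂ → Matrix (Fin d × Fin n) (Fin d × Fin n) ℂ :=
    fun z => svdPow U' t V' ((-(ρ / 2) : ℝ) * z + (ρ : ℝ))
  let F : ℂ → Matrix (Fin d × Fin n) (Fin d × Fin n) ℂ :=
    fun z => ampl n (E z) * (ampl n (S z) * L z)
  have hF : StripBounded fun z => (F z * Γ z).trace :=
    MatStripBounded.trace (((MatStripBounded.svdPow U V hs _ _).ampl.mul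
      ((MatStripBounded.matPow W hμ0 _ _).ampl.mul (MatStripBounded.matPow R hl0 _ _))).mul
      (MatStripBounded.svdPow U' V' ht _ _))
  have hmid : F (1 / x : ℝ) * Γ (1 / x : ℝ) =
      ampl n C * (ampl n (matPow W μ (-(1 / (2 * x)) : ℝ)) * matPow R l (1 / 2 : ℝ)) * G := by
    have e1 : ((x : ℝ) : ℂ) * ((1 / x : ℝ) : ℂ) + (0 : ℝ) = 1 := by
      rw [← Complex.ofReal_mul, ← Complex.ofReal_add, ← Complex.ofReal_one]
      congr 1; field_simp; simp
    have e2 : ((-(1 / 2) : ℝ) : ℂ) * ((1 / x : ℝ) : ℂ) + (0 : ℝ) = (-(1 / (2 * x)) : ℝ) := by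
      rw [← Complex.ofReal_mul, ← Complex.ofReal_add]
      congr 1; field_simp; simp
    have e3 : ((x / 2 : ℝ) : ℂ) * ((1 / x : ℝ) : ℂ) + (0 : ℝ) = (1 / 2 : ℝ) := by
      rw [← Complex.ofReal_mul, ← Complex.ofReal_add]
      congr 1; field_simp; simp
    have e4 : ((-(ρ / 2) : ℝ) : ℂ) * ((1 / x : ℝ) : ℂ) + (ρ : ℝ) = 1 := by
      rw [← Complex.ofReal_mul, ← Complex.ofReal_add, ← Complex.ofReal_one]
      congr 1
      have : -(ρ / 2) * (1 / x) + ρ = ρ * (1 - 1 / (2 * x)) := by field_simp; ring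
      rw [this, hinv]
    simp only [F, Γ, E, S, L]
    rw [e1, e2, e3, e4, svdPow_one U V hs, svdPow_one U' V' ht, ← hCs, ← hGs]
  rw [← h, ← hmid]
  refine hF.enorm_le (z := (1 / x : ℝ)) (fun z hz => ?_) (fun z hz => ?_) ?_ ?_
  · have hE : ‖E z‖ ≤ 1 := norm_svdPow_le_one hU hV hs (by simp [hz])
    have hS : ‖S z‖ ≤ 1 := norm_matPow_le_one hW hμ0 (by simp [hz])
    have hL : ‖L z‖ ≤ 1 := norm_matPow_le_one hR hl0 (by simp [hz])
    have hFz : ‖F z‖ ≤ 1 := norm_mul_le_one ((norm_ampl_le _).trans hE)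
      (norm_mul_le_one ((norm_ampl_le _).trans hS) hL)
    -- The contraction `F z` plays the role of the left multiplier, leaving the pairing of `Γ z`
    -- with the identity.
    have h1 := enorm_trace_le 1 ∞ hFz norm_one_matrix_le (Γ z) 1
    rw [Matrix.mul_one, Matrix.mul_one] at h1
    refine h1.trans (mul_le_one' ?_ ?_)
    · have hw : ((-(ρ / 2) : ℝ) * z + (ρ : ℝ) : ℂ).re = ρ := by simp [hz]
      refine (schattenNorm_svdPow_le le_rfl hU' hV' ht (by rw [hw]; exact hρ0.ne')).trans ?_
      rw [hw]
      exact lpSum_rpow_le_one hρ0 ENNReal.one_ne_top hrtop (by simp [hρ]) ht hG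
    · have h2 := schattenNorm_eq_lpSum (ι := Fin d × Fin n) (A := 1) (s := fun _ => 1) ∞
        (one_mem _) (one_mem _) (fun _ => zero_le_one) (by simp)
      rw [h2, lpSum_top]
      exact iSup_le fun _ => by simp
  · refine (enorm_trace_mul_le 2 2 (F z) (Γ z)).trans (mul_le_one' ?_ ?_)
    -- The imaginary power of `σ` is moved into `E'`, so that `E z * S z = E' σ^{-1/2}`. The partial
    -- trace of `L z * (L z)ᴴ` is `σ`, which cancels both factors `σ^{-1/2}` and leaves the
    -- Hilbert-Schmidt norm of `E'`.
    · set E' := E z * matPow W μ (-(z.im / 2) * Complex.I) with hE'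
      have hEz : schattenNorm 2 E' ≤ 1 := by
        have h1 := schattenNorm_contraction_le one_le_two norm_one_matrix_le
          (norm_matPow_le_one hW hμ0 (w := -(z.im / 2) * Complex.I) (by simp)) (E z)
        rw [Matrix.one_mul] at h1
        refine h1.trans ?_
        have hw : ((x : ℝ) * z + (0 : ℝ) : ℂ).re = x := by simp [hz]
        refine (schattenNorm_svdPow_le one_le_two hU hV hs (by rw [hw]; exact hx0.ne')).trans ?_
        rw [hw]
        exact lpSum_rpow_le_one hx0 ENNReal.ofNat_ne_top hq2' (by simp [hx]) hs hC
      refine le_trans (le_of_eq ?_) hEz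
      rw [schattenNorm_two', schattenNorm_two']
      congr 3
      set B := matPow W μ (-(1 / 2) : ℝ) with hB
      have hES : E z * S z = E' * B := by
        rw [hE', hB, Matrix.mul_assoc, matPow_mul hW]
        simp only [S]
        congr 2
        apply Complex.ext <;> simp [hz]
        ring
      have hLL : L z * (L z)ᴴ = matPow R l x := by
        simp only [L]
        rw [matPow_mul_conjTranspose hR hl]
        congr 2
        simp [hz]
        ring
      have hBσ : B * matPow W μ 1 * Bᴴ = 1 := by
        rw [hB, matPow_ofReal_conjTranspose W hμ, matPow_mul hW, matPow_mul hW,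
          ← matPow_zero hW hμ]
        congr 1; push_cast; ring
      have hFF : F z * (F z)ᴴ = ampl n (E' * B) * matPow R l x * ampl n (E' * B)ᴴ := by
        simp only [F]
        rw [← Matrix.mul_assoc, ← ampl_mul, hES, conjTranspose_mul, ampl_conjTranspose, ← hLL]
        simp only [Matrix.mul_assoc]
      rw [hFF, trace_mul_comm, ← Matrix.mul_assoc, ← ampl_mul, trace_ampl_mul, hσ, Matrix.mul_assoc,
        trace_mul_comm]
      have : E' * B * matPow W μ 1 * (E' * B)ᴴ = E' * (B * matPow W μ 1 * Bᴴ) * E'ᴴ := by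
        simp only [conjTranspose_mul, Matrix.mul_assoc]
      rw [this, hBσ, Matrix.mul_one]
    · have hw : ((-(ρ / 2) : ℝ) * z + (ρ : ℝ) : ℂ).re = ρ / 2 := by simp [hz]; ring
      refine (schattenNorm_svdPow_le one_le_two hU' hV' ht (by rw [hw]; positivity)).trans ?_
      rw [hw]
      exact lpSum_rpow_le_one (by positivity) ENNReal.ofNat_ne_top hrtop
        (by simp [hρ]; ring) ht hG
  · simp; positivity
  · simp; exact inv_le_one_of_one_le₀ hx1

end

/-! ### Agreement of the `(q,q)` norm with the Schatten norm on positive matrices. -/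

section
open Matrix Filter Topology
open scoped Matrix.Norms.L2Operator

variable {d n : ℕ}

/-- With `σ = Tr₂ Q^q`, the outer factors `σ^{1/(2q)}` have squared `2q`-norm `(Tr σ)^{1/q} =
‖Q‖_q`. The middle factor is `T Tᴴ` with `T = σ^{-1/(2q)} Q^{1/2}`, of `(∞,q)` norm at most `1` by
Hölder and the interpolation estimate. Positivity of `n` keeps `σ` definite. -/
theorem mixedNorm_le_schattenNorm_of_posDef (hn : 0 < n) {q : ℝ≥0∞} (hq : 1 ≤ q) (hq' : q ≠ ∞)
    {Q : Matrix (Fin d × Fin n) (Fin d × Fin n) ℂ} (hQ : Q.PosDef) :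
    mixedNorm q q Q ≤ schattenNorm q Q := by
  have hq2 := one_le_two_mul hq
  have hq0 : 2 * q ≠ 0 := (zero_lt_one.trans_le hq2).ne'
  have hq2' : 2 * q ≠ ∞ := ENNReal.mul_ne_top ENNReal.ofNat_ne_top hq'
  set x := q.toReal with hx
  have hx0 : 0 < x := ENNReal.toReal_pos (zero_lt_one.trans_le hq).ne' hq'
  obtain ⟨R, hR, l, hl, hQR⟩ := exists_eq_matPow hQ
  obtain ⟨W, hW, μ, hμ, hσ⟩ := exists_eq_matPow (partialTrace_posDef hn (matPow_posDef hR hl x))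
  set A := matPow W μ (1 / (2 * x) : ℝ) with hA
  set N := matPow W μ (-(1 / (2 * x)) : ℝ) with hN
  have hAN : A * N = 1 := by
    rw [hA, hN, matPow_mul hW, ← matPow_zero hW hμ]; congr 1; push_cast; ring
  have hNA : N * A = 1 := by
    rw [hA, hN, matPow_mul hW, ← matPow_zero hW hμ]; congr 1; push_cast; ring
  have hNH : Nᴴ = N := matPow_ofReal_conjTranspose W hμ _
  set T := ampl n N * matPow R l (1 / 2 : ℝ) with hT
  have hTT : T * Tᴴ = ampl n N * Q * ampl n N := by
    rw [hT, conjTranspose_mul, ampl_conjTranspose, hNH, matPow_ofReal_conjTranspose R hl]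
    have : matPow R l (1 / 2 : ℝ) * matPow R l (1 / 2 : ℝ) = Q := by
      rw [matPow_mul hR, hQR]; congr 1; push_cast; ring
    rw [← this]
    simp only [Matrix.mul_assoc]
  have hfac : Q = ampl n A * (T * Tᴴ) * ampl n A := by
    rw [hTT]
    have e1 : ampl n A * ampl n N = 1 := by rw [← ampl_mul, hAN, ampl_one]
    have e2 : ampl n N * ampl n A = 1 := by rw [← ampl_mul, hNA, ampl_one]
    simp only [Matrix.mul_assoc]
    rw [e2, Matrix.mul_one, ← Matrix.mul_assoc, e1, Matrix.one_mul]
  have hCT : ∀ C : Matrix (Fin d) (Fin d) ℂ,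
      schattenNorm (2 * q) (ampl n C * T) ≤ schattenNorm (2 * q) C := by
    intro C
    rcases eq_or_ne C 0 with rfl | hC
    · simp [ampl, schattenNorm_zero hq2]
    obtain ⟨c, hc⟩ := exists_coe_eq (schattenNorm_ne_top hq2 C)
    have hc0 : c ≠ 0 := fun h => schattenNorm_ne_zero hq0 hC (by rw [← hc, h]; rfl)
    have hc0' : (c : ℂ) ≠ 0 := by exact_mod_cast hc0
    have hce : ‖(c : ℂ)‖ₑ = c := by rw [← ofReal_norm]; simp
    have h1 : schattenNorm (2 * q) ((c : ℂ)⁻¹ • C) ≤ 1 := by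
      rw [schattenNorm_smul hq2, ← hc, ← hce, ← enorm_mul, inv_mul_cancel₀ hc0', enorm_one]
    have h2 := schattenNorm_ampl_mul_le_one hq hq' hR hl hW hμ hσ h1
    have h3 : ampl n C * T = (c : ℂ) • (ampl n ((c : ℂ)⁻¹ • C) * T) := by
      simp only [ampl, smul_kronecker, Matrix.smul_mul, smul_smul, mul_inv_cancel₀ hc0', one_smul]
    rw [h3, schattenNorm_smul hq2, hce, hc]
    exact mul_le_of_le_one_right' h2
  have hZ : normInf q (T * Tᴴ) ≤ 1 := by
    refine normInf_le fun C D => ?_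
    have e : ampl n C * (T * Tᴴ) * ampl n D = (ampl n C * T) * (ampl n Dᴴ * T)ᴴ := by
      rw [conjTranspose_mul (ampl n Dᴴ) T, ampl_conjTranspose, conjTranspose_conjTranspose]
      simp only [Matrix.mul_assoc]
    rw [e, mul_one]
    refine (schattenNorm_mul_le hq _ _).trans (mul_le_mul' (hCT C) ?_)
    rw [schattenNorm_conjTranspose]
    exact (hCT _).trans (schattenNorm_conjTranspose _ _).le
  have hAn : schattenNorm (2 * q) A * schattenNorm (2 * q) A = schattenNorm q Q := by
    have h1 := schattenNorm_matPow hW hμ (2 * q) (1 / (2 * x))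
    have h2 := schattenNorm_matPow hR hl q 1
    rw [Complex.ofReal_one, ← hQR] at h2
    have htr : ∑ i, l i ^ x = ∑ i, μ i := by
      have e1 := trace_partialTrace (matPow R l x)
      have e2 := trace_matPow hW hμ 1
      rw [Complex.ofReal_one] at e2
      rw [hσ, e2, trace_matPow hR hl] at e1
      have := Complex.ofReal_injective e1
      simpa using this.symm
    rw [← hA] at h1
    rw [h1, h2, lpSum, lpSum, if_neg hq', if_neg hq2', ← sq, ← ENNReal.rpow_natCast,
      ← ENNReal.rpow_mul]
    have e1 : ∑ i, ENNReal.ofReal (μ i ^ (1 / (2 * x))) ^ (2 * q).toReal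
        = ENNReal.ofReal (∑ i, μ i) := by
      rw [ENNReal.ofReal_sum_of_nonneg fun i _ => (hμ i).le]
      refine Finset.sum_congr rfl fun i _ => ?_
      rw [ENNReal.ofReal_rpow_of_nonneg (Real.rpow_nonneg (hμ i).le _) ENNReal.toReal_nonneg,
        ← Real.rpow_mul (hμ i).le, ENNReal.toReal_mul, ← hx]
      rw [show 1 / (2 * x) * (ENNReal.toReal 2 * x) = 1 by simp; field_simp, Real.rpow_one]
    have e2 : ∑ i, ENNReal.ofReal (l i ^ (1 : ℝ)) ^ q.toReal = ENNReal.ofReal (∑ i, l i ^ x) := by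
      rw [ENNReal.ofReal_sum_of_nonneg fun i _ => Real.rpow_nonneg (hl i).le _]
      refine Finset.sum_congr rfl fun i _ => ?_
      rw [Real.rpow_one, ENNReal.ofReal_rpow_of_nonneg (hl i).le ENNReal.toReal_nonneg]
    rw [e1, e2, htr, ENNReal.toReal_mul, ← hx]
    congr 1
    simp
  refine (mixedNorm_le q q hfac).trans ?_
  rw [hAn]
  exact mul_le_of_le_one_right' hZ

/-- On positive semidefinite matrices, the norm of `L_q(M_d; L_q(M_n))` is at most the Schatten
`q`-norm. -/
theorem mixedNorm_le_schattenNorm_of_posSemidef (hn : 0 < n) {q : ℝ≥0∞} (hq : 1 ≤ q)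
    {Q : Matrix (Fin d × Fin n) (Fin d × Fin n) ℂ} (hQ : Q.PosSemidef) :
    mixedNorm q q Q ≤ schattenNorm q Q := by
  by_cases hq' : q = ∞
  · subst hq'
    have h1 := mixedNorm_le ∞ ∞ (A := 1) (B := 1) (Z := Q) (Y := Q) (by simp [ampl_one])
    have h2 : schattenNorm (2 * ∞) (1 : Matrix (Fin d) (Fin d) ℂ) ≤ 1 := by
      have h2 := schattenNorm_eq_lpSum (ι := Fin d) (A := 1) (s := fun _ => 1) ∞
        (one_mem _) (one_mem _) (fun _ => zero_le_one) (by simp)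
      rw [ENNReal.mul_top two_ne_zero, h2, lpSum_top]
      exact iSup_le fun _ => by simp
    refine h1.trans ((mul_le_of_le_one_left' (mul_le_one' h2 h2)).trans ?_)
    exact normInf_le_schattenNorm hq Q
  have hle : ∀ ε : NNReal, 0 < ε → mixedNorm q q Q ≤ schattenNorm q Q +
      ε * schattenNorm q (1 : Matrix (Fin d × Fin n) (Fin d × Fin n) ℂ) := by
    intro ε hε
    have hε1 : (((ε : ℂ)) • (1 : Matrix (Fin d × Fin n) (Fin d × Fin n) ℂ)).PosDef := by
      refine PosDef.smul PosDef.one ?_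
      exact_mod_cast hε
    have hpd : (Q + (ε : ℂ) • (1 : Matrix (Fin d × Fin n) (Fin d × Fin n) ℂ)).PosDef :=
      PosDef.posSemidef_add hQ hε1
    -- Cauchy-Schwarz for this block matrix gives the monotonicity `‖Q‖ ≤ ‖Q + ε‖` in the mixed
    -- norm, which transfers the definite case as `ε → 0`.
    have hb : (fromBlocks (Q + (ε : ℂ) • 1) Q Qᴴ (Q + (ε : ℂ) • 1)).PosSemidef := by
      have h1 := hQ.mul_mul_conjTranspose_same
        (fromRows (1 : Matrix (Fin d × Fin n) (Fin d × Fin n) ℂ)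
          (1 : Matrix (Fin d × Fin n) (Fin d × Fin n) ℂ))
      rw [conjTranspose_fromRows_eq_fromCols_conjTranspose, conjTranspose_one, fromRows_mul,
        fromRows_mul_fromCols, Matrix.one_mul, Matrix.mul_one] at h1
      have h2 : (fromBlocks ((ε : ℂ) • 1) 0 0 ((ε : ℂ) • 1) :
          Matrix ((Fin d × Fin n) ⊕ (Fin d × Fin n)) _ ℂ).PosSemidef := by
        have : ((ε : ℂ) • (1 : Matrix ((Fin d × Fin n) ⊕ (Fin d × Fin n)) _ ℂ)).PosSemidef := by
          refine PosSemidef.smul PosSemidef.one ?_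
          exact_mod_cast hε.le
        rwa [← fromBlocks_one, fromBlocks_smul, smul_zero] at this
      have h3 := h1.add h2
      rw [hQ.isHermitian.eq]
      simpa [fromBlocks_add] using h3
    have h1 := mixedNorm_sq_le_of_posSemidef hq hq hb
    rw [← sq, ENNReal.pow_le_pow_left_iff two_ne_zero] at h1
    refine (h1.trans (mixedNorm_le_schattenNorm_of_posDef hn hq hq' hpd)).trans ?_
    refine (schattenNorm_add_le hq _ _).trans (le_of_eq ?_)
    rw [schattenNorm_smul hq]
    congr 2
    rw [← ofReal_norm]
    simp
  obtain ⟨α, hα⟩ := exists_coe_eq (schattenNorm_ne_top hq Q)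
  obtain ⟨κ, hκ⟩ := exists_coe_eq
    (schattenNorm_ne_top hq (1 : Matrix (Fin d × Fin n) (Fin d × Fin n) ℂ))
  rw [← hα]
  rw [← hα, ← hκ] at hle
  have hcont : Continuous fun ε : NNReal => ((α + ε * κ : NNReal) : ℝ≥0∞) :=
    ENNReal.continuous_coe.comp (by fun_prop)
  have hlim : Tendsto (fun ε : NNReal => ((α + ε * κ : NNReal) : ℝ≥0∞)) (𝓝[>] 0) (𝓝 (α : ℝ≥0∞)) := by
    have := (hcont.tendsto 0).mono_left (nhdsWithin_le_nhds (s := Set.Ioi 0))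
    simpa using this
  refine ge_of_tendsto hlim (eventually_nhdsWithin_of_forall fun ε hε => ?_)
  push_cast
  exact hle ε hε

theorem schattenNorm_le_mixedNorm {q : ℝ≥0∞} (hq : 1 ≤ q)
    (Y : Matrix (Fin d × Fin n) (Fin d × Fin n) ℂ) : schattenNorm q Y ≤ mixedNorm q q Y := by
  refine le_iInf₂ fun A B => le_iInf₂ fun Z h => ?_
  rw [h]
  exact schattenNorm_le_normInf hq Z A B

theorem mixedNorm_eq_schattenNorm_of_posSemidef (hn : 0 < n) {q : ℝ≥0∞} (hq : 1 ≤ q)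
    {Q : Matrix (Fin d × Fin n) (Fin d × Fin n) ℂ} (hQ : Q.PosSemidef) :
    mixedNorm q q Q = schattenNorm q Q :=
  le_antisymm (mixedNorm_le_schattenNorm_of_posSemidef hn hq hQ) (schattenNorm_le_mixedNorm hq Q)

end

/-! ### Block positivity of the map, semicontinuity, compactness, and the main theorem. -/

section
open Matrix Filter Topology

variable {d m n : ℕ}

theorem idTensor_smul (Φ : Matrix (Fin m) (Fin m) ℂ →ₗ[ℂ] Matrix (Fin n) (Fin n) ℂ) (c : ℂ)
    (Y : Matrix (Fin d × Fin m) (Fin d × Fin m) ℂ) :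
    idTensor d Φ (c • Y) = c • idTensor d Φ Y := by
  ext x y
  have := congrFun (congrFun (Φ.map_smul c (Matrix.of fun k l => Y (x.1, k) (y.1, l))) x.2) y.2
  exact this

theorem continuous_idTensor (Φ : Matrix (Fin m) (Fin m) ℂ →ₗ[ℂ] Matrix (Fin n) (Fin n) ℂ) :
    Continuous (idTensor d Φ) := by
  have hΦ : Continuous Φ := LinearMap.continuous_of_finiteDimensional Φ
  refine continuous_matrix fun x y => ?_
  have h1 : Continuous fun Y : Matrix (Fin d × Fin m) (Fin d × Fin m) ℂ =>
      (Matrix.of fun k l => Y (x.1, k) (y.1, l) : Matrix (Fin m) (Fin m) ℂ) :=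
    continuous_matrix fun k l => continuous_id.matrix_elem _ _
  exact (hΦ.comp h1).matrix_elem x.2 y.2

/-- A two-by-two block matrix over `M_d ⊗ M_m` is an element of `M_{2d} ⊗ M_m` up to reindexing, so
complete positivity applies with `k = d + d`. -/
theorem IsCompletelyPositive.fromBlocks
    {Φ : Matrix (Fin m) (Fin m) ℂ →ₗ[ℂ] Matrix (Fin n) (Fin n) ℂ} (hΦ : IsCompletelyPositive Φ)
    {X Y W : Matrix (Fin d × Fin m) (Fin d × Fin m) ℂ}
    (h : (fromBlocks X Y Yᴴ W).PosSemidef) :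
    (fromBlocks (idTensor d Φ X) (idTensor d Φ Y) (idTensor d Φ Y)ᴴ
      (idTensor d Φ W)).PosSemidef := by
  let e : Fin (d + d) × Fin m → (Fin d × Fin m) ⊕ (Fin d × Fin m) := fun x =>
    Sum.map (fun i => (i, x.2)) (fun i => (i, x.2)) (finSumFinEquiv.symm x.1)
  let e' : (Fin d × Fin n) ⊕ (Fin d × Fin n) → Fin (d + d) × Fin n :=
    Sum.elim (fun x => (Fin.castAdd d x.1, x.2)) fun x => (Fin.natAdd d x.1, x.2)
  have h1 := (hΦ (d + d) _ (h.submatrix e)).submatrix e'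
  have h2 : (idTensor (d + d) Φ ((Matrix.fromBlocks X Y Yᴴ W).submatrix e e)).submatrix e' e' =
      Matrix.fromBlocks (idTensor d Φ X) (idTensor d Φ Y) (idTensor d Φ Yᴴ) (idTensor d Φ W) := by
    ext (x | x) (y | y) <;> simp [idTensor, e, e', submatrix, -Fin.natAdd_eq_addNat]
  rw [h2] at h1
  -- The image block matrix is Hermitian, and this alone shows that the map commutes with adjoints
  -- on `Y`.
  have h3 := (isHermitian_fromBlocks_iff.1 h1.isHermitian).2.1
  rwa [h3]

theorem tendsto_sum_enorm_sub {ι κ : Type*} [Fintype ι] {f : κ → Matrix ι ι ℂ} {l : Filter κ}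
    {A : Matrix ι ι ℂ} (hf : Tendsto f l (𝓝 A)) :
    Tendsto (fun x => ∑ i, ∑ j, ‖(f x - A) i j‖ₑ) l (𝓝 0) := by
  have hc : Continuous fun B : Matrix ι ι ℂ => ∑ i, ∑ j, ‖(B - A) i j‖ₑ :=
    continuous_finsetSum _ fun i _ => continuous_finsetSum _ fun j _ =>
      (((continuous_id.sub continuous_const).matrix_elem i j)).enorm
  have := (hc.tendsto A).comp hf
  simpa [Function.comp_def] using this

theorem continuous_schattenNorm {ι : Type*} [Fintype ι] [DecidableEq ι] {p : ℝ≥0∞} (hp : 1 ≤ p) :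
    Continuous (schattenNorm p : Matrix ι ι ℂ → ℝ≥0∞) := by
  rw [continuous_iff_continuousAt]
  intro A
  have hδ := tendsto_sum_enorm_sub (tendsto_id (x := 𝓝 A))
  have hA := schattenNorm_ne_top hp A
  have hup := (tendsto_const_nhds (x := schattenNorm p A) (f := 𝓝 A)).add hδ
  have hlo := ENNReal.Tendsto.sub (tendsto_const_nhds (x := schattenNorm p A) (f := 𝓝 A)) hδ
    (Or.inl hA)
  rw [add_zero] at hup
  rw [tsub_zero] at hlo
  refine tendsto_of_tendsto_of_tendsto_of_le_of_le hlo hup (fun B => ?_) fun B => ?_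
  · refine tsub_le_iff_right.2 ?_
    have h1 := schattenNorm_add_le hp B ((-1 : ℂ) • (B - A))
    rw [schattenNorm_smul hp] at h1
    have h2 : B + (-1 : ℂ) • (B - A) = A := by simp
    rw [h2, enorm_neg, enorm_one, one_mul] at h1
    exact h1.trans (add_le_add le_rfl (schattenNorm_le_sum hp _))
  · have h1 := schattenNorm_add_le hp A (B - A)
    rw [add_sub_cancel] at h1
    exact h1.trans (add_le_add le_rfl (schattenNorm_le_sum hp _))

theorem isClosed_posSemidef {ι : Type*} [Fintype ι] :
    IsClosed {A : Matrix ι ι ℂ | A.PosSemidef} := by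
  have : {A : Matrix ι ι ℂ | A.PosSemidef} =
      {A | Aᴴ = A} ∩ ⋂ x : ι → ℂ, {A | 0 ≤ star x ⬝ᵥ (A *ᵥ x)} := by
    ext A
    simp [posSemidef_iff_dotProduct_mulVec, IsHermitian]
  rw [this]
  refine (isClosed_eq (by fun_prop) continuous_id).inter (isClosed_iInter fun x => ?_)
  exact isClosed_le continuous_const (by fun_prop)

theorem isCompact_posSemidef_schattenNorm_eq_one {ι : Type*} [Fintype ι] [DecidableEq ι]
    {p : ℝ≥0∞} (hp : 1 ≤ p) :
    IsCompact {A : Matrix ι ι ℂ | A.PosSemidef ∧ schattenNorm p A = 1} := by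
  have hK : IsCompact (Set.univ.pi fun _ : ι => Set.univ.pi fun _ : ι => Metric.closedBall (0 : ℂ) 1) :=
    isCompact_univ_pi fun _ => isCompact_univ_pi fun _ => isCompact_closedBall _ _
  refine IsCompact.of_isClosed_subset (X := Matrix ι ι ℂ) hK (isClosed_posSemidef.inter
    (isClosed_eq (continuous_schattenNorm hp) continuous_const)) ?_
  intro A hA i _ j _
  rw [mem_closedBall_zero_iff]
  exact norm_entry_le
    (norm_le_one_of_schattenNorm_le_one (zero_lt_one.trans_le hp).ne' hA.2.le) i j

theorem mixedNorm_smul_le {t p : ℝ≥0∞} (hp : 1 ≤ p) {c : ℂ} (hc : c ≠ 0)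
    (Y : Matrix (Fin d × Fin n) (Fin d × Fin n) ℂ) :
    mixedNorm t p (c • Y) ≤ ‖c‖ₑ * mixedNorm t p Y := by
  have h0 : ‖c‖ₑ ≠ 0 := enorm_ne_zero.2 hc
  have h1 : ‖c‖ₑ ≠ ∞ := enorm_ne_top
  conv_rhs => simp only [mixedNorm]
  simp only [ENNReal.mul_iInf_of_ne h0 h1]
  refine le_iInf₂ fun A B => le_iInf₂ fun Z h => ?_
  have := mixedNorm_le t p (Y := c • Y) (A := A) (B := B) (Z := c • Z) (by
    rw [h, Matrix.mul_smul, Matrix.smul_mul])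
  refine this.trans ?_
  rw [mul_left_comm]
  gcongr
  exact normInf_smul_le hp c Z

/-- A near-optimal factorization at `x` with invertible outer factor `a` also factors every nearby
`f y`: only the middle changes, and it varies continuously. The Hermitian hypothesis provides the
invertible `a`. -/
theorem upperSemicontinuousAt_mixedNorm {κ : Type*} [TopologicalSpace κ] {t p : ℝ≥0∞} (ht : 1 ≤ t)
    (hp : 1 ≤ p) {f : κ → Matrix (Fin d × Fin n) (Fin d × Fin n) ℂ} {x : κ}
    (hf : ContinuousAt f x) (hx : (f x).IsHermitian) :
    UpperSemicontinuousAt (fun y => mixedNorm t p (f y)) x := by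
  intro c hc
  obtain ⟨a, H, ha, hfa, hlt⟩ := exists_symmetric_factorization_of_lt ht hp hx hc
  have ea := ampl_inv_mul (n := n) ha
  have ea' := ampl_mul_inv (n := n) ha
  have ea2 := congrArg conjTranspose ea
  have ea2' := congrArg conjTranspose ea'
  rw [conjTranspose_mul, conjTranspose_one] at ea2 ea2'
  let g : κ → Matrix (Fin d × Fin n) (Fin d × Fin n) ℂ :=
    fun y => ampl n a⁻¹ * f y * (ampl n a⁻¹)ᴴ
  have hg : Tendsto g (𝓝 x) (𝓝 H) := by
    have h1 : Tendsto g (𝓝 x) (𝓝 (g x)) :=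
      (((continuous_const.matrix_mul continuous_id).matrix_mul continuous_const).tendsto _).comp hf
    have h2 : g x = H := by
      simp only [g]
      rw [hfa]
      simp only [Matrix.mul_assoc]
      rw [ea2, Matrix.mul_one, ← Matrix.mul_assoc, ea, Matrix.one_mul]
    rwa [h2] at h1
  have ht2 := one_le_two_mul ht
  have hlim : Tendsto (fun y => schattenNorm (2 * t) a ^ 2 *
      (normInf p H + ∑ i, ∑ j, ‖(g y - H) i j‖ₑ)) (𝓝 x)
      (𝓝 (schattenNorm (2 * t) a ^ 2 * normInf p H)) := by
    have h1 := (tendsto_const_nhds (x := normInf p H) (f := 𝓝 x)).add (tendsto_sum_enorm_sub hg)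
    rw [add_zero] at h1
    exact ENNReal.Tendsto.const_mul h1 (Or.inr (ENNReal.pow_ne_top (schattenNorm_ne_top ht2 a)))
  filter_upwards [hlim.eventually_lt_const hlt] with y hy
  refine lt_of_le_of_lt ?_ hy
  have hfy : f y = ampl n a * g y * ampl n aᴴ := by
    simp only [g]
    rw [← ampl_conjTranspose a]
    simp only [Matrix.mul_assoc]
    rw [ea2', Matrix.mul_one, ← Matrix.mul_assoc, ea', Matrix.one_mul]
  have h1 := mixedNorm_le t p hfy
  rw [schattenNorm_conjTranspose, ← sq] at h1
  refine h1.trans ?_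
  gcongr
  have h2 := normInf_add_le hp H (g y - H)
  rw [add_sub_cancel] at h2
  exact h2.trans (add_le_add le_rfl
    ((normInf_le_schattenNorm hp _).trans (schattenNorm_le_sum hp _)))

/-- `|Aᴴ|`, `A`, `|A|` form a positive semidefinite block matrix. -/
theorem exists_posSemidef_fromBlocks {ι : Type*} [Fintype ι] [DecidableEq ι] (p : ℝ≥0∞)
    (A : Matrix ι ι ℂ) : ∃ X W : Matrix ι ι ℂ, X.PosSemidef ∧ W.PosSemidef ∧
      schattenNorm p X = schattenNorm p A ∧ schattenNorm p W = schattenNorm p A ∧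
      (fromBlocks X A Aᴴ W).PosSemidef := by
  obtain ⟨U, hU, V, hV, s, hs, hA⟩ := exists_svd' A
  have hD : (diagonal fun i => (s i : ℂ)).PosSemidef :=
    PosSemidef.diagonal fun i => Complex.zero_le_real.2 (hs i)
  have hb := hD.mul_mul_conjTranspose_same (fromRows U Vᴴ)
  rw [conjTranspose_fromRows_eq_fromCols_conjTranspose, fromRows_mul, fromRows_mul_fromCols,
    conjTranspose_conjTranspose, ← hA] at hb
  have hA' : Vᴴ * (diagonal fun i => (s i : ℂ)) * Uᴴ = Aᴴ := by
    rw [hA]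
    simp only [conjTranspose_mul, hD.isHermitian.eq, Matrix.mul_assoc]
  rw [hA'] at hb
  refine ⟨_, _, ?_, ?_, ?_, ?_, hb⟩
  · exact hD.mul_mul_conjTranspose_same U
  · simpa using hD.conjTranspose_mul_mul_same V
  · rw [schattenNorm_eq_lpSum p hU hV hs hA]
    exact schattenNorm_eq_lpSum p hU (Unitary.star_mem hU) hs rfl
  · rw [schattenNorm_eq_lpSum p hU hV hs hA]
    exact schattenNorm_eq_lpSum p (Unitary.star_mem hV) hV hs rfl

end

end CBNorm

open Matrix Filter Topology CBNorm in
theorem mainTheorem7 (d m n : ℕ) (hd : 0 < d) (hm : 0 < m) (q p : ℝ≥0∞) (hq : 1 ≤ q) (hqp : q ≤ p)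
    (Φ : Matrix (Fin m) (Fin m) ℂ →ₗ[ℂ] Matrix (Fin n) (Fin n) ℂ)
    (hΦ : CBNorm.IsCompletelyPositive Φ) :
    CBNorm.opNorm q q q p (CBNorm.idTensor d Φ) = CBNorm.opNormPos q q q p (CBNorm.idTensor d Φ) ∧
    ∃ Q : Matrix (Fin d × Fin m) (Fin d × Fin m) ℂ, Q ≠ 0 ∧ Q.PosSemidef ∧
      CBNorm.mixedNorm q p (CBNorm.idTensor d Φ Q) / CBNorm.mixedNorm q q Q
        = CBNorm.opNorm q q q p (CBNorm.idTensor d Φ) := by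
  have hp : 1 ≤ p := hq.trans hqp
  have hq0 : q ≠ 0 := (zero_lt_one.trans_le hq).ne'
  have hnormalize : ∀ Q : Matrix (Fin d × Fin m) (Fin d × Fin m) ℂ, Q ≠ 0 → Q.PosSemidef →
      ∃ c : ℂ, c ≠ 0 ∧ ‖c‖ₑ = schattenNorm q Q ∧ (c⁻¹ • Q).PosSemidef ∧
        schattenNorm q (c⁻¹ • Q) = 1 := by
    intro Q hQ0 hQ
    obtain ⟨c, hc⟩ := exists_coe_eq (schattenNorm_ne_top hq Q)
    have hc0 : c ≠ 0 := fun h => schattenNorm_ne_zero hq0 hQ0 (by rw [← hc, h]; rfl)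
    have hc0' : (c : ℂ) ≠ 0 := by exact_mod_cast hc0
    have hce : ‖(c : ℂ)‖ₑ = c := by rw [← ofReal_norm]; simp
    refine ⟨c, hc0', hce.trans hc, hQ.smul ?_, ?_⟩
    · have : (0 : ℝ) ≤ (c : ℝ)⁻¹ := by positivity
      exact_mod_cast this
    · rw [schattenNorm_smul hq, ← hc, ← hce, ← enorm_mul, inv_mul_cancel₀ hc0', enorm_one]
  have hpsd : ∀ Q : Matrix (Fin d × Fin m) (Fin d × Fin m) ℂ, Q.PosSemidef →
      (idTensor d Φ Q).PosSemidef := fun Q hQ => hΦ d Q hQ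
  let K := {Q : Matrix (Fin d × Fin m) (Fin d × Fin m) ℂ | Q.PosSemidef ∧ schattenNorm q Q = 1}
  have hKne : K.Nonempty := by
    have : Nonempty (Fin d × Fin m) := ⟨(⟨0, hd⟩, ⟨0, hm⟩)⟩
    obtain ⟨c, -, -, h1, h2⟩ := hnormalize 1 one_ne_zero PosSemidef.one
    exact ⟨_, h1, h2⟩
  -- Upper semicontinuity suffices for a maximum on a compact set. The set is normalized by the
  -- Schatten norm, which is continuous, rather than by the mixed norm.
  have husc : UpperSemicontinuousOn (fun Q => mixedNorm q p (idTensor d Φ Q)) K := fun Q hQ =>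
    (upperSemicontinuousAt_mixedNorm hq hp (continuous_idTensor Φ).continuousAt
      (hpsd Q hQ.1).isHermitian).upperSemicontinuousWithinAt K
  obtain ⟨Q₀, hQ₀, hmax⟩ := husc.exists_isMaxOn hKne (isCompact_posSemidef_schattenNorm_eq_one hq)
  set M := mixedNorm q p (idTensor d Φ Q₀) with hM
  have hpos : ∀ Q : Matrix (Fin d × Fin m) (Fin d × Fin m) ℂ, Q ≠ 0 → Q.PosSemidef →
      mixedNorm q p (idTensor d Φ Q) ≤ schattenNorm q Q * M := by
    intro Q hQ0 hQ
    obtain ⟨c, hc0, hc, h1, h2⟩ := hnormalize Q hQ0 hQ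
    have h3 : idTensor d Φ Q = c • idTensor d Φ (c⁻¹ • Q) := by
      rw [← idTensor_smul, smul_inv_smul₀ hc0]
    rw [h3, ← hc]
    refine (mixedNorm_smul_le hp hc0 _).trans ?_
    gcongr
    exact hmax (show c⁻¹ • Q ∈ K from ⟨h1, h2⟩)
  have hall : ∀ Q : Matrix (Fin d × Fin m) (Fin d × Fin m) ℂ, Q ≠ 0 →
      mixedNorm q p (idTensor d Φ Q) ≤ schattenNorm q Q * M := by
    intro Q hQ0
    -- `X` and `W` have the Schatten norm of `Q`, so the bound on positive matrices applied to both
    -- and Cauchy-Schwarz give the same constant `M` for `Q`.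
    obtain ⟨X, W, hX, hW, hXn, hWn, hb⟩ := exists_posSemidef_fromBlocks q Q
    have hne : ∀ Y : Matrix (Fin d × Fin m) (Fin d × Fin m) ℂ,
        schattenNorm q Y = schattenNorm q Q → Y ≠ 0 := by
      rintro Y h rfl
      rw [schattenNorm_zero hq] at h
      exact schattenNorm_ne_zero hq0 hQ0 h.symm
    have h1 := mixedNorm_sq_le_of_posSemidef hq hp (hΦ.fromBlocks hb)
    have h2 := hpos X (hne X hXn) hX
    have h3 := hpos W (hne W hWn) hW
    rw [hXn] at h2
    rw [hWn] at h3
    rw [← ENNReal.pow_le_pow_left_iff two_ne_zero]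
    exact h1.trans ((mul_le_mul' h2 h3).trans (sq _).symm.le)
  -- For general `Q` only `‖Q‖_q ≤ ‖Q‖_{(q,q)}` is needed, since enlarging the denominator lowers
  -- the ratio.
  have hle : opNorm q q q p (idTensor d Φ) ≤ M := by
    refine iSup₂_le fun Q hQ0 => ENNReal.div_le_of_le_mul ?_
    rw [mul_comm]
    exact (hall Q hQ0).trans (mul_le_mul' (schattenNorm_le_mixedNorm hq Q) le_rfl)
  have hQ₀0 : Q₀ ≠ 0 := by
    intro h
    have := hQ₀.2
    rw [h, schattenNorm_zero hq] at this
    exact zero_ne_one this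
  -- At the positive maximizer the two norms agree, so the ratio is exactly `M`.
  have hratio : mixedNorm q p (idTensor d Φ Q₀) / mixedNorm q q Q₀ = M := by
    rw [mixedNorm_eq_schattenNorm_of_posSemidef hm hq hQ₀.1, hQ₀.2, div_one]
  have hge : M ≤ opNormPos q q q p (idTensor d Φ) := by
    rw [← hratio]
    exact le_iSup₂_of_le Q₀ hQ₀0 (le_iSup_of_le hQ₀.1 le_rfl)
  have hpn : opNormPos q q q p (idTensor d Φ) ≤ opNorm q q q p (idTensor d Φ) :=
    iSup₂_mono fun Q _ => iSup_le fun _ => le_rfl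
  have heq : opNorm q q q p (idTensor d Φ) = M := le_antisymm hle (hge.trans hpn)
  exact ⟨le_antisymm (hle.trans hge) hpn, Q₀, hQ₀0, hQ₀.1, hratio.trans heq.symm⟩
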